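/- Let $n\ge 2$. For a nonempty compact convex set $K\subset\mathbb R^n$ containing the origin $o$, and $u\in S^{n-1}$, let $h_K(u)=\max\{\langle u,x\rangle:x\in K\}$, $\rho_K(u)=\max\{\lambda\ge 0:\lambda u\in K\}$, $r_K(u)=\rho_K(u)u$, and for $z\in K$ let $N(K,z)=\{y\in\mathbb R^n:\langle y,x-z\rangle\le 0\text{ for all }x\in K\}$. For $E\subset S^{n-1}$ put $\nu_K^{-1}(E)=\{x\in\partial K:N(K,x)\cap E\ne\emptyset\}$ and $\alpha_K^*(E)=r_K^{-1}(\nu_K^{-1}(E))\subset S^{n-1}$, and let $\Xi_K=\nu_K^{-1}(S^{n-1}\cap N(K,o))$. Write $\mathcal H^{n-1}$ for $(n-1)$-dimensional Hausdorff measure, and $du=d\mathcal H^{n-1}(u)$ on $S^{n-1}$. Let $G:[0,\infty)\times S^{n-1}\to[0,\infty)$ be continuous, such that $G_t=\partial G/\partial t$ exists and is positive on $(0,\infty)\times S^{n-1}$ and such that $tG_t(t,u)$, with the value $0$ at $t=0$, is continuous on $[0,\infty)\times S^{n-1}$. For Borel sets $E\subset S^{n-1}$ let $$\widetilde C_G(K,E)=\frac1n\int_{\alpha_K^*(E\setminus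 N(K,o))}\rho_K(u)\,G_t(\rho_K(u),u)\,du .$$ Let $\psi:(0,\infty)\to(0,\infty)$ be continuous with $\lim_{t\to0+}\psi(t)/t=0$ and $\int_1^\infty\frac{\psi(s)}{s}\,ds=\infty$, and extend $\psi$ continuously by $\psi(0)=0$. Let $\mu$ be a finite Borel measure on $S^{n-1}$. Then the following are equivalent: (i) $\mu$ is not concentrated on any closed hemisphere, i.e. $\int_{S^{n-1}}\max\{\langle u,v\rangle,0\}\,d\mu(u)>0$ for every $v\in S^{n-1}$. (ii) There exist a compact convex set $K\subset\mathbb R^n$ with $o\in K$ and nonempty interior, and $\tau>0$, such that $\mathcal H^{n-1}(\Xi_K)=0$ and $$(\psi\circ h_K)\,\mu=\tau\,\widetilde C_G(K,\cdot)$$ as Borel measures on $S^{n-1}$, where $$\tau=\frac{1}{\widetilde C_G(K,S^{n-1})}\int_{S^{n-1}}\psi(h_K(u))\,d\mu(u).$$ -/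

import Mathlib

open MeasureTheory Set Filter Topology

noncomputable section

namespace DualMinkowski

/-- The Euclidean space `ℝⁿ`. -/
abbrev Rn (n : ℕ) : Type := EuclideanSpace ℝ (Fin n)

/-- The unit sphere `Sⁿ⁻¹` of `ℝⁿ`. -/
abbrev Sph (n : ℕ) : Type := Metric.sphere (0 : Rn n) 1

variable {n : ℕ}

/-- A measure on the sphere is not concentrated on any closed hemisphere:
`∫ ⟨u, v⟩₊ dμ(u) > 0` for all unit vectors `v`. -/
def NotConcentratedOnClosedHemisphere (μ : Measure (Sph n)) : Prop :=
  ∀ v : Sph n, 0 < ∫ u : Sph n, max (inner ℝ (u : Rn n) (v : Rn n)) 0 ∂μ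

/-- The support function `h_K(u) = max {⟨u, x⟩ : x ∈ K}`. -/
def supportFn (K : Set (Rn n)) (u : Rn n) : ℝ :=
  sSup ((fun x : Rn n => inner ℝ u x) '' K)

/-- The radial function `ρ_K(x) = max {r ≥ 0 : r x ∈ K}`, for `x ≠ 0` and `K` compact, convex
and containing the origin. -/
def radialFn (K : Set (Rn n)) (x : Rn n) : ℝ :=
  sSup {r : ℝ | 0 ≤ r ∧ r • x ∈ K}

/-- The radial map `r_K(u) = ρ_K(u) u`. -/
def radialMap (K : Set (Rn n)) (u : Sph n) : Rn n :=
  radialFn K (u : Rn n) • (u : Rn n)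

/-- The normal cone `N(K, z)`. -/
def normalCone (K : Set (Rn n)) (z : Rn n) : Set (Rn n) :=
  {y | ∀ x ∈ K, inner ℝ y (x - z) ≤ 0}

/-- The unit vectors in the normal cone `N(K, o)` at the origin. -/
def unitNormals (K : Set (Rn n)) : Set (Sph n) :=
  {u | (u : Rn n) ∈ normalCone K 0}

/-- The reverse spherical image `ν_K⁻¹(E)`: the boundary points of `K` that have an outer normal
vector in `E`. -/
def reverseSphericalImage (K : Set (Rn n)) (E : Set (Sph n)) : Set (Rn n) :=
  {x | x ∈ frontier K ∧ ∃ u ∈ E, (u : Rn n) ∈ normalCone K x}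

/-- The set `Ξ_K = ν_K⁻¹(Sⁿ⁻¹ ∩ N(K, o))`. -/
def Xi (K : Set (Rn n)) : Set (Rn n) :=
  reverseSphericalImage K (unitNormals K)

/-- The reverse radial spherical image `α*_K(E) = r_K⁻¹(ν_K⁻¹(E))`. -/
def reverseRadialSphericalImage (K : Set (Rn n)) (E : Set (Sph n)) : Set (Sph n) :=
  radialMap K ⁻¹' reverseSphericalImage K E

/-- The general dual curvature measure
`C̃_G(K, E) = (1/n) ∫_{α*_K(E \ N(K, o))} ρ_K(u) G_t(ρ_K(u), u) du`.
Here `du` is `(n - 1)`-dimensional Hausdorff measure on the sphere, i.e. the spherical Lebesgue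
measure `volume.toSphere` (of total mass `n κ_n`). Where `ρ_K(u) = 0` the integrand is `0`,
in agreement with the convention `t G_t(t, u) = 0` at `t = 0`. -/
def dualCurvature (G : ℝ → Sph n → ℝ) (K : Set (Rn n)) (E : Set (Sph n)) : ℝ :=
  (1 / (n : ℝ)) *
    ∫ u in reverseRadialSphericalImage K (E \ unitNormals K),
      radialFn K (u : Rn n) * deriv (fun t : ℝ => G t u) (radialFn K (u : Rn n))
      ∂((volume : Measure (Rn n)).toSphere)

end DualMinkowski

end

/-!
The solution `K` is found variationally. Put `φ(s) = ψ(s) / s`, extended by `0`, and let `Φ` be its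
primitive. Among the convex bodies containing the origin whose dual volume `∫ G(ρ_K(u), u) du` is
at least that of the unit ball, one minimises the Orlicz energy `∫ Φ(h_K) dμ`
(`exists_minimizer`). The divergence of `∫ ψ(s) / s ds` makes `Φ` unbounded, so if `μ` is not
concentrated on a closed hemisphere, bodies of bounded energy lie in a common ball. Blaschke
selection then applies, the energy is lower semicontinuous, and the dual volume is upper
semicontinuous. The bound on the dual volume forces the minimiser to have interior points. The
origin may lie on its boundary.

The minimiser is perturbed through the Wulff shapes of `h_K + t g`. In almost every direction `u`
either `ρ_K(u) = 0`, or the boundary point `ρ_K(u) u` has a unique normal `α_K(u)`, whose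
supporting hyperplane misses the origin (`ae_isRegularDirection_or`). This holds because the gauge
of `K` is convex on the cone over the interior of `K`, hence differentiable almost everywhere there.
In such directions a one-sided Alexandrov formula bounds the first variation of the dual volume
from below by `ρ G_t(ρ, u) g(α_K(u)) / h_K(α_K(u))`, and Fatou's lemma turns minimality into an
inequality (`integral_nonneg_of_minimizer`).

* For `g = f h_K` this inequality gives the Euler–Lagrange equation
  (`IsMinimizer.exists_multiplier`). It is the required identity of measures, because the dual
  curvature measure is the push-forward of `ρ G_t(ρ, u) du / n` under `α_K`
  (`dualCurvature_eq_setIntegral`).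
* For `g = 1 - s h_K` it gives that `Ξ_K` is negligible
  (`IsMinimizer.hausdorffMeasure_Xi_eq_zero`). As `φ(0) = 0`, pushing `K` out near the normals at
  the origin costs no energy to first order, whereas a set `Ξ_K` of positive measure makes new
  directions of measure at least proportional to `t` visible from the origin, which a packing
  argument shows.

Conversely, if `Ξ_K` is negligible, then for every direction `v` some boundary point outside `Ξ_K`
has only normals that make an acute angle with `v`, and the directions close to that point give
`{u : ⟨u, v⟩ > 0}` positive dual curvature (`dualCurvature_pos`). Hence `μ` charges every open
hemisphere.
-/

namespace DualMinkowski

/-! ### Support functions, radial functions and Wulff shapes -/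

section Basics

variable {n : ℕ} (K : ConvexBody (Rn n))

theorem bddAbove_image_inner (u : Rn n) :
    BddAbove ((fun x : Rn n => inner ℝ u x) '' (K : Set (Rn n))) :=
  (K.isCompact.image (by fun_prop)).bddAbove

variable {K} in
theorem inner_le_supportFn {x : Rn n} (hx : x ∈ K) (u : Rn n) : inner ℝ u x ≤ supportFn K u :=
  le_csSup (bddAbove_image_inner K u) ⟨x, hx, rfl⟩

theorem exists_inner_eq_supportFn (u : Rn n) : ∃ x ∈ K, inner ℝ u x = supportFn K u := by
  obtain ⟨x, hx, h⟩ := (K.isCompact.image (f := fun x : Rn n => inner ℝ u x)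
    (by fun_prop)).sSup_mem (K.nonempty.image _)
  exact ⟨x, hx, h⟩

variable {K} in
theorem supportFn_le {u : Rn n} {c : ℝ} (h : ∀ x ∈ K, inner ℝ u x ≤ c) : supportFn K u ≤ c := by
  obtain ⟨x, hx, h'⟩ := exists_inner_eq_supportFn K u
  exact h' ▸ h x hx

theorem continuous_supportFn : Continuous (supportFn (K : Set (Rn n))) := by
  have := K.isCompact.continuous_sSup (f := fun (u x : Rn n) => (inner ℝ u x : ℝ))
    (by fun_prop)
  exact this

variable {K} in
theorem supportFn_nonneg (h0 : 0 ∈ K) (u : Rn n) : 0 ≤ supportFn K u := by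
  simpa using inner_le_supportFn h0 u

variable {K} in
theorem add_le_supportFn_of_closedBall_subset {z : Rn n} {a : ℝ} (ha : 0 ≤ a)
    (h : Metric.closedBall z a ⊆ K) (u : Sph n) :
    inner ℝ (u : Rn n) z + a ≤ supportFn K (u : Rn n) := by
  have hu : ‖(u : Rn n)‖ = 1 := by simp
  have hm : z + a • (u : Rn n) ∈ K := h (by simp [norm_smul, abs_of_nonneg ha])
  have := inner_le_supportFn hm (u : Rn n)
  rwa [inner_add_right, inner_smul_right, real_inner_self_eq_norm_sq, hu, one_pow, mul_one] at this

/-- A convex body is the intersection of its supporting half-spaces. -/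
theorem mem_iff_forall_inner_le {x : Rn n} :
    x ∈ K ↔ ∀ u : Sph n, inner ℝ (u : Rn n) x ≤ supportFn K (u : Rn n) := by
  refine ⟨fun hx u => inner_le_supportFn hx _, fun h => ?_⟩
  by_contra hx
  obtain ⟨f, c, hf1, hf2⟩ := geometric_hahn_banach_closed_point K.convex K.isClosed hx
  set y := (InnerProductSpace.toDual ℝ (Rn n)).symm f with hy
  have hfy : ∀ z, f z = inner ℝ y z := fun z => by
    rw [hy, InnerProductSpace.toDual_symm_apply]
  have hy0 : y ≠ 0 := by
    intro h0
    obtain ⟨z, hz⟩ := K.nonempty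
    have h1 := hf1 z hz
    rw [hfy, h0, inner_zero_left] at h1
    rw [hfy, h0, inner_zero_left] at hf2
    linarith
  have hn : 0 < ‖y‖ := norm_pos_iff.2 hy0
  let u : Sph n := ⟨(‖y‖)⁻¹ • y, by simp [norm_smul, hn.ne']⟩
  have h2 := h u
  obtain ⟨z, hz, hz'⟩ := exists_inner_eq_supportFn K (u : Rn n)
  rw [← hz'] at h2
  simp only [u, real_inner_smul_left] at h2
  have h3 := le_of_mul_le_mul_left h2 (inv_pos.2 hn)
  have h4 := hf1 z hz
  rw [hfy] at h4 hf2
  linarith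

/-- The interior points are those strictly inside all supporting half-spaces: by compactness of
the sphere the slack is uniform. -/
theorem mem_interior_iff_forall_inner_lt {x : Rn n} :
    x ∈ interior (K : Set (Rn n)) ↔
      ∀ u : Sph n, inner ℝ (u : Rn n) x < supportFn K (u : Rn n) := by
  constructor
  · intro hx u
    obtain ⟨a, ha, hb⟩ := Metric.nhds_basis_closedBall.mem_iff.1 (mem_interior_iff_mem_nhds.1 hx)
    linarith [add_le_supportFn_of_closedBall_subset ha.le hb u]
  · intro h
    rw [mem_interior_iff_mem_nhds]
    have : ∀ᶠ y in 𝓝 x, ∀ u ∈ (univ : Set (Sph n)),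
        inner ℝ (u : Rn n) y < supportFn K (u : Rn n) := by
      refine isCompact_univ.eventually_forall_of_forall_eventually fun u _ => ?_
      have hc : Continuous fun z : Rn n × Sph n => (inner ℝ (z.2 : Rn n) z.1 : ℝ) := by fun_prop
      have hc' : Continuous fun z : Rn n × Sph n => supportFn (K : Set (Rn n)) (z.2 : Rn n) :=
        (continuous_supportFn K).comp (by fun_prop)
      exact hc.continuousAt.eventually_lt hc'.continuousAt (h u)
    filter_upwards [this] with y hy
    exact (mem_iff_forall_inner_le K).2 fun u => (hy u trivial).le

theorem mem_frontier_iff {x : Rn n} :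
    x ∈ frontier (K : Set (Rn n)) ↔
      x ∈ K ∧ ∃ u : Sph n, inner ℝ (u : Rn n) x = supportFn K (u : Rn n) := by
  rw [K.isClosed.frontier_eq, Set.mem_sdiff, mem_interior_iff_forall_inner_lt]
  refine and_congr_right fun hx => ?_
  push Not
  exact exists_congr fun u => ⟨fun h => le_antisymm (inner_le_supportFn hx _) h, fun h => h.ge⟩

theorem mem_normalCone_iff {x y : Rn n} (hx : x ∈ K) :
    y ∈ normalCone (K : Set (Rn n)) x ↔ inner ℝ y x = supportFn K y := by
  constructor
  · intro h
    refine le_antisymm (inner_le_supportFn hx y) (supportFn_le fun z hz => ?_)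
    have := h z hz
    rw [inner_sub_right] at this
    linarith
  · intro h z hz
    rw [inner_sub_right, h]
    linarith [inner_le_supportFn hz y]

theorem mem_unitNormals_iff (h0 : 0 ∈ K) {u : Sph n} :
    u ∈ unitNormals (K : Set (Rn n)) ↔ supportFn K (u : Rn n) = 0 := by
  rw [unitNormals, mem_ofPred_eq, mem_normalCone_iff K h0, inner_zero_right, eq_comm]

/-! ### The radial function -/

variable {K}

theorem bddAbove_radial (u : Sph n) : BddAbove {r : ℝ | 0 ≤ r ∧ r • (u : Rn n) ∈ (K : Set (Rn n))} := by
  obtain ⟨R, hR⟩ := K.isBounded.exists_norm_le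
  refine ⟨R, fun r hr => ?_⟩
  have := hR _ hr.2
  simpa [norm_smul, abs_of_nonneg hr.1] using this

theorem smul_mem_of_le {x : Rn n} (h0 : 0 ∈ K) (hx : x ∈ K) {t : ℝ} (h : 0 ≤ t) (h1 : t ≤ 1) :
    t • x ∈ K := by
  have := K.convex.smul_mem_of_zero_mem h0 hx ⟨h, h1⟩
  exact this

theorem radialFn_nonneg (K : ConvexBody (Rn n)) (x : Rn n) : 0 ≤ radialFn K x :=
  Real.sSup_nonneg fun _ h => h.1

theorem radialMap_mem (h0 : 0 ∈ K) (u : Sph n) : radialFn K (u : Rn n) • (u : Rn n) ∈ K := by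
  have hne : {r : ℝ | 0 ≤ r ∧ r • (u : Rn n) ∈ (K : Set (Rn n))}.Nonempty :=
    ⟨0, le_rfl, by simpa using h0⟩
  have hcl : IsClosed {r : ℝ | 0 ≤ r ∧ r • (u : Rn n) ∈ (K : Set (Rn n))} :=
    isClosed_Ici.inter (K.isClosed.preimage (f := fun r : ℝ => r • (u : Rn n)) (by fun_prop))
  exact (hcl.csSup_mem hne (bddAbove_radial u)).2

theorem le_radialFn {u : Sph n} {r : ℝ} (hr : 0 ≤ r) (h : r • (u : Rn n) ∈ K) :
    r ≤ radialFn K (u : Rn n) :=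
  le_csSup (bddAbove_radial u) ⟨hr, h⟩

theorem le_radialFn_iff (h0 : 0 ∈ K) {u : Sph n} {r : ℝ} (hr : 0 ≤ r) :
    r ≤ radialFn K (u : Rn n) ↔ r • (u : Rn n) ∈ K := by
  refine ⟨fun h => ?_, le_radialFn hr⟩
  rcases hr.eq_or_lt with rfl | hr
  · simpa using h0
  have hρ := hr.trans_le h
  have := smul_mem_of_le h0 (radialMap_mem h0 u) (t := r / radialFn K (u : Rn n))
    (by positivity) ((div_le_one hρ).2 h)
  rwa [smul_smul, div_mul_cancel₀ _ hρ.ne'] at this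

theorem radialFn_le_of_subset_closedBall {R : ℝ} (hR : 0 ≤ R)
    (h : (K : Set (Rn n)) ⊆ Metric.closedBall 0 R)
    (u : Sph n) : radialFn K (u : Rn n) ≤ R := by
  refine Real.sSup_le (fun r hr => ?_) hR
  have := h hr.2
  simpa [norm_smul, abs_of_nonneg hr.1] using this

theorem measurable_radialFn (h0 : 0 ∈ K) :
    Measurable fun u : Sph n => radialFn (K : Set (Rn n)) (u : Rn n) := by
  refine measurable_of_Ici fun r => ?_
  rcases le_total 0 r with hr | hr
  · have : (fun u : Sph n => radialFn (K : Set (Rn n)) (u : Rn n)) ⁻¹' Ici r =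
        (fun u : Sph n => r • (u : Rn n)) ⁻¹' (K : Set (Rn n)) := by
      ext u
      exact le_radialFn_iff h0 hr
    rw [this]
    exact (K.isClosed.preimage (by fun_prop)).measurableSet
  · have : (fun u : Sph n => radialFn (K : Set (Rn n)) (u : Rn n)) ⁻¹' Ici r = univ := by
      ext u
      simpa using hr.trans (radialFn_nonneg K _)
    rw [this]
    exact MeasurableSet.univ

theorem inner_radialMap_le (h0 : 0 ∈ K) (u v : Sph n) :
    radialFn K (u : Rn n) * inner ℝ (v : Rn n) (u : Rn n) ≤ supportFn K (v : Rn n) := by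
  simpa [inner_smul_right] using inner_le_supportFn (radialMap_mem h0 u) (v : Rn n)

/-- The point `ρ_K(u) u` lies on the boundary: some unit vector is normal there. -/
theorem exists_normal_radialMap (h0 : 0 ∈ K) (u : Sph n) : ∃ v : Sph n,
    radialFn K (u : Rn n) * inner ℝ (v : Rn n) (u : Rn n) = supportFn K (v : Rn n) := by
  by_contra! h
  have h1 : radialFn K (u : Rn n) • (u : Rn n) ∈ interior (K : Set (Rn n)) := by
    rw [mem_interior_iff_forall_inner_lt]
    intro v
    rw [inner_smul_right]
    exact lt_of_le_of_ne (inner_radialMap_le h0 u v) (h v)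
  have hc : ContinuousAt (fun r : ℝ => r • (u : Rn n)) (radialFn K (u : Rn n)) := by fun_prop
  have h2 : ∀ᶠ r in 𝓝 (radialFn K (u : Rn n)), r • (u : Rn n) ∈ (K : Set (Rn n)) :=
    hc (mem_interior_iff_mem_nhds.1 h1)
  obtain ⟨r, hr, hr2⟩ := (h2.filter_mono nhdsWithin_le_nhds |>.and
    (self_mem_nhdsWithin (s := Ioi (radialFn K (u : Rn n))))).exists
  exact absurd (le_radialFn ((radialFn_nonneg K _).trans hr2.le) hr) (not_le.2 hr2)

/-! ### Wulff shapes -/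

/-- The Wulff shape `{x : ⟨v, x⟩ ≤ g(v) for all unit vectors v}` of a continuous nonnegative
function `g` on the sphere. -/
noncomputable def wulffShape (g : Sph n → ℝ) (hg : ∀ v, 0 ≤ g v) (hgc : Continuous g) :
    ConvexBody (Rn n) where
  carrier := {x | ∀ v : Sph n, inner ℝ (v : Rn n) x ≤ g v}
  convex' := by
    rw [ofPred_forall]
    exact convex_iInter fun v => convex_halfSpace_le (innerₛₗ ℝ (v : Rn n)).isLinear (g v)
  isCompact' := by
    obtain ⟨R, hR⟩ := isCompact_univ.exists_bound_of_continuousOn hgc.continuousOn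
    refine Metric.isCompact_of_isClosed_isBounded ?_ ?_
    · rw [ofPred_forall]
      exact isClosed_iInter fun v => isClosed_le (by fun_prop) continuous_const
    · refine (Metric.isBounded_closedBall (x := (0 : Rn n)) (r := max R 0)).subset fun x hx => ?_
      rw [mem_closedBall_zero_iff]
      rcases eq_or_ne x 0 with rfl | h0
      · simp
      have hn : 0 < ‖x‖ := norm_pos_iff.2 h0
      have h1 := hx ⟨(‖x‖)⁻¹ • x, by simp [norm_smul, hn.ne']⟩
      simp only [real_inner_smul_left, real_inner_self_eq_norm_sq] at h1
      rw [pow_two, inv_mul_cancel_left₀ hn.ne'] at h1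
      exact h1.trans ((le_abs_self _).trans ((hR _ trivial).trans (le_max_left _ _)))
  nonempty' := ⟨0, fun v => by simpa using hg v⟩

theorem zero_mem_wulffShape {g : Sph n → ℝ} {hg : ∀ v, 0 ≤ g v} {hgc : Continuous g} :
    (0 : Rn n) ∈ wulffShape g hg hgc := fun v => by simpa using hg v

theorem supportFn_wulffShape_le {g : Sph n → ℝ} {hg : ∀ v, 0 ≤ g v} {hgc : Continuous g}
    (v : Sph n) : supportFn (wulffShape g hg hgc) (v : Rn n) ≤ g v :=
  supportFn_le fun _ hx => hx v

end Basics

/-! ### Fatou's lemma for functions bounded below -/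

/-- Fatou's lemma for real functions with a common lower bound; the hypothesis `hlim` says that
`f ≤ liminf F i` almost everywhere. -/
theorem eventually_lt_integral_of_liminf {α : Type*} [MeasurableSpace α] {m : Measure α}
    [IsFiniteMeasure m] {f : α → ℝ} {F : ℕ → α → ℝ} {M : ℝ} (hf : Integrable f m)
    (hF : ∀ i, Integrable (F i) m) (hM : ∀ i x, -M ≤ F i x)
    (hlim : ∀ᵐ x ∂m, ∀ c < f x, ∀ᶠ i in atTop, c < F i x) {a : ℝ} (ha : a < ∫ x, f x ∂m) :
    ∀ᶠ i in atTop, a < ∫ x, F i x ∂m := by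
  have hcst : ∀ g : α → ℝ, Integrable g m →
      ∫ x, (g x + M) ∂m = ∫ x, g x ∂m + m.real univ * M := fun g hg => by
    rw [integral_add hg (integrable_const _), integral_const, smul_eq_mul]
  have h1 : ENNReal.ofReal (∫ x, (f x + M) ∂m) ≤ ∫⁻ x, ENNReal.ofReal (f x + M) ∂m := by
    have hi : Integrable (fun x => f x + M) m := hf.add (integrable_const _)
    have : ∫ x, (f x + M) ∂m ≤ ∫ x, max (f x + M) 0 ∂m :=
      integral_mono hi hi.pos_part fun x => le_max_left _ _
    refine (ENNReal.ofReal_le_ofReal this).trans ?_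
    rw [ofReal_integral_eq_lintegral_ofReal hi.pos_part
      (Eventually.of_forall fun x => le_max_right _ _)]
    exact lintegral_mono fun x => by simp
  have h2 : ∫⁻ x, ENNReal.ofReal (f x + M) ∂m
      ≤ ∫⁻ x, liminf (fun i => ENNReal.ofReal (F i x + M)) atTop ∂m := by
    refine lintegral_mono_ae ?_
    filter_upwards [hlim] with x hx
    refine le_of_forall_lt fun b hb => ?_
    obtain ⟨c, hbc, hc⟩ := exists_between hb
    have hct : c ≠ ⊤ := (hc.trans ENNReal.ofReal_lt_top).ne
    refine hbc.trans_le (le_liminf_of_le (by isBoundedDefault) ?_)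
    have h3 : c.toReal < f x + M := (ENNReal.lt_ofReal_iff_toReal_lt hct).1 hc
    filter_upwards [hx (c.toReal - M) (by linarith)] with i hi
    exact ((ENNReal.lt_ofReal_iff_toReal_lt hct).2 (by linarith)).le
  have h3 := lintegral_liminf_le' (μ := m) (u := atTop) (f := fun (i : ℕ) x => ENNReal.ofReal (F i x + M))
    (fun i => ((hF i).add (integrable_const M)).aestronglyMeasurable.aemeasurable.ennreal_ofReal)
  have hnn : ∀ i, 0 ≤ ∫ x, (F i x + M) ∂m := fun i =>
    integral_nonneg fun x => by simpa using (by linarith [hM i x] : 0 ≤ F i x + M)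
  by_cases h0 : a + m.real univ * M < 0
  · refine Eventually.of_forall fun i => ?_
    have := hnn i
    rw [hcst _ (hF i)] at this
    linarith
  have h4 : ENNReal.ofReal (a + m.real univ * M) < ENNReal.ofReal (∫ x, (f x + M) ∂m) := by
    rw [hcst f hf]
    exact (ENNReal.ofReal_lt_ofReal_iff (by linarith)).2 (by linarith)
  filter_upwards [eventually_lt_of_lt_liminf (h4.trans_le (h1.trans (h2.trans h3)))] with i hi
  have hFi : Integrable (fun x => F i x + M) m := (hF i).add (integrable_const _)
  rw [← ofReal_integral_eq_lintegral_ofReal hFi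
    (Eventually.of_forall fun x => by simpa using (by linarith [hM i x] : 0 ≤ F i x + M))] at hi
  have h5 := ENNReal.ofReal_lt_ofReal_iff'.1 hi
  rw [hcst _ (hF i)] at h5
  linarith [h5.1]

/-! ### Selecting convergent sequences of convex bodies -/

section Blaschke

theorem exists_subseq_tendsto_infDist_of_isCompact {α : Type*} [MetricSpace α] {B : Set α}
    (hB : IsCompact B) (N : ℕ → TopologicalSpace.NonemptyCompacts α)
    (hN : ∀ i, (N i : Set α) ⊆ B) :
    ∃ (L : TopologicalSpace.NonemptyCompacts α) (k : ℕ → ℕ), StrictMono k ∧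
      ∀ x, Tendsto (fun i => Metric.infDist x (N (k i) : Set α)) atTop
        (𝓝 (Metric.infDist x (L : Set α))) := by
  obtain ⟨L, -, k, hk, hL⟩ :=
    (TopologicalSpace.NonemptyCompacts.isCompact_subsets_of_isCompact
      hB).tendsto_subseq (x := N) hN
  exact ⟨L, k, hk, fun x => ((Metric.lipschitz_infDist_set x).continuous.tendsto L).comp hL⟩

variable {n : ℕ}

theorem exists_mem_dist_eq_infDist (K : ConvexBody (Rn n)) (x : Rn n) :
    ∃ y ∈ K, dist x y = Metric.infDist x K := by
  obtain ⟨y, hy, h⟩ := K.isCompact.exists_infDist_eq_dist K.nonempty x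
  exact ⟨y, hy, h.symm⟩

theorem mem_iff_infDist_eq_zero {K : ConvexBody (Rn n)} {x : Rn n} :
    x ∈ K ↔ Metric.infDist x K = 0 :=
  K.isClosed.mem_iff_infDist_zero K.nonempty

/-- Blaschke selection, with convergence expressed through the distance functions. -/
theorem exists_subseq_tendsto_infDist (K : ℕ → ConvexBody (Rn n)) {R : ℝ}
    (hR : ∀ i, (K i : Set (Rn n)) ⊆ Metric.closedBall 0 R) :
    ∃ (L : ConvexBody (Rn n)) (k : ℕ → ℕ), StrictMono k ∧
      ∀ x, Tendsto (fun i => Metric.infDist x (K (k i))) atTop (𝓝 (Metric.infDist x (L : Set (Rn n)))) := by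
  obtain ⟨L, k, hk, hd⟩ := exists_subseq_tendsto_infDist_of_isCompact
    (isCompact_closedBall (0 : Rn n) R)
    (fun i => ⟨⟨K i, (K i).isCompact⟩, (K i).nonempty⟩) hR
  replace hd : ∀ x, Tendsto (fun i => Metric.infDist x (K (k i) : Set (Rn n))) atTop
      (𝓝 (Metric.infDist x (L : Set (Rn n)))) := hd
  suffices hconv : Convex ℝ (L : Set (Rn n)) from
    ⟨⟨(L : Set (Rn n)), hconv, L.isCompact, L.nonempty⟩, k, hk, hd⟩
  intro x hx y hy a b ha hb hab
  have hx0 := hd x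
  have hy0 := hd y
  rw [Metric.infDist_zero_of_mem hx] at hx0
  rw [Metric.infDist_zero_of_mem hy] at hy0
  refine (L.isCompact.isClosed.mem_iff_infDist_zero L.nonempty).2
    (le_antisymm ?_ Metric.infDist_nonneg)
  refine le_of_tendsto_of_tendsto (hd _)
    (by simpa using (hx0.const_mul a).add (hy0.const_mul b)) (Eventually.of_forall fun i => ?_)
  obtain ⟨x', hx', hxd⟩ := exists_mem_dist_eq_infDist (K (k i)) x
  obtain ⟨y', hy', hyd⟩ := exists_mem_dist_eq_infDist (K (k i)) y
  refine (Metric.infDist_le_dist_of_mem ((K (k i)).convex hx' hy' ha hb hab)).trans ?_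
  simp only [← hxd, ← hyd]
  refine (dist_add_add_le _ _ _ _).trans ?_
  rw [dist_smul₀, dist_smul₀, Real.norm_of_nonneg ha, Real.norm_of_nonneg hb]

variable {K : ℕ → ConvexBody (Rn n)} {L : ConvexBody (Rn n)}

theorem zero_mem_of_tendsto_infDist (h0 : ∀ i, 0 ∈ K i)
    (h : ∀ x, Tendsto (fun i => Metric.infDist x (K i)) atTop (𝓝 (Metric.infDist x (L : Set (Rn n))))) :
    0 ∈ L := by
  have h1 := h 0
  simp_rw [fun i => mem_iff_infDist_eq_zero.1 (h0 i)] at h1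
  exact mem_iff_infDist_eq_zero.2 (tendsto_nhds_unique h1 tendsto_const_nhds)

/-- The support function is lower semicontinuous along a convergent sequence of bodies. -/
theorem eventually_lt_supportFn
    (h : ∀ x, Tendsto (fun i => Metric.infDist x (K i)) atTop (𝓝 (Metric.infDist x (L : Set (Rn n)))))
    (u : Sph n) {c : ℝ} (hc : c < supportFn L (u : Rn n)) :
    ∀ᶠ i in atTop, c < supportFn (K i) (u : Rn n) := by
  obtain ⟨x, hx, hxu⟩ := exists_inner_eq_supportFn L (u : Rn n)
  have h1 := h x
  rw [mem_iff_infDist_eq_zero.1 hx] at h1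
  filter_upwards [h1.eventually_lt_const (sub_pos.2 hc)] with i hi
  obtain ⟨y, hy, hyd⟩ := exists_mem_dist_eq_infDist (K i) x
  rw [← hyd] at hi
  have h2 := inner_le_supportFn hy (u : Rn n)
  have h3 : inner ℝ (u : Rn n) x - inner ℝ (u : Rn n) y ≤ dist x y := by
    rw [← inner_sub_right, dist_eq_norm]
    simpa using real_inner_le_norm (u : Rn n) (x - y)
  linarith

/-- The radial function is upper semicontinuous along a convergent sequence of bodies. -/
theorem eventually_radialFn_lt (h0 : ∀ i, 0 ∈ K i)
    (h : ∀ x, Tendsto (fun i => Metric.infDist x (K i)) atTop (𝓝 (Metric.infDist x (L : Set (Rn n)))))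
    (u : Sph n) {c : ℝ} (hc : radialFn L (u : Rn n) < c) :
    ∀ᶠ i in atTop, radialFn (K i) (u : Rn n) < c := by
  have hc0 : 0 ≤ c := (radialFn_nonneg L _).trans hc.le
  have h1 : c • (u : Rn n) ∉ L := fun hm => absurd (le_radialFn hc0 hm) (not_le.2 hc)
  have h2 : 0 < Metric.infDist (c • (u : Rn n)) L :=
    lt_of_le_of_ne Metric.infDist_nonneg fun h' => h1 (mem_iff_infDist_eq_zero.2 h'.symm)
  filter_upwards [(h (c • (u : Rn n))).eventually_const_lt h2] with i hi
  by_contra! hle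
  rw [mem_iff_infDist_eq_zero.1 ((le_radialFn_iff (h0 i) hc0).1 hle)] at hi
  exact lt_irrefl _ hi

end Blaschke

/-! ### Spherical measure -/

/-- The spherical Lebesgue measure on `Sⁿ⁻¹`. -/
noncomputable abbrev sphereMeasure (n : ℕ) : Measure (Sph n) :=
  (volume : Measure (Rn n)).toSphere

/-- A positively homogeneous property that holds almost everywhere in space holds in almost every
direction: in polar coordinates, almost every ray meets the full-measure set. -/
theorem ae_sphere_of_ae {n : ℕ} {Q : Rn n → Prop} (h : ∀ᵐ x ∂(volume : Measure (Rn n)), Q x)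
    (hQ : ∀ x, ∀ t : ℝ, 0 < t → Q (t • x) → Q x) : ∀ᵐ u : Sph n ∂(sphereMeasure n), Q (u : Rn n) := by
  have h1 : ∀ᵐ x : ({0}ᶜ : Set (Rn n)) ∂((volume : Measure (Rn n)).comap ((↑) : ({0}ᶜ : Set (Rn n)) → Rn n)),
      Q (x : Rn n) := by
    have hme : MeasurableEmbedding ((↑) : ({0}ᶜ : Set (Rn n)) → Rn n) :=
      MeasurableEmbedding.subtype_coe (measurableSet_singleton _).compl
    exact hme.ae_map_iff.1 (by rw [hme.map_comap]; exact ae_restrict_of_ae h)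
  have hmp := (volume : Measure (Rn n)).measurePreserving_homeomorphUnitSphereProd
  have h2 := (hmp.symm (homeomorphUnitSphereProd (Rn n)).toMeasurableEquiv).quasiMeasurePreserving.ae
    h1
  have h3 := Measure.ae_ae_of_ae_prod h2
  refine h3.mono fun u hu => ?_
  have : NeBot (ae (Measure.volumeIoiPow (Module.finrank ℝ (Rn n) - 1))) := by
    rw [ae_neBot]
    intro h0
    have h4 := Measure.volumeIoiPow_apply_Iio (Module.finrank ℝ (Rn n) - 1) ⟨1, mem_Ioi.2 one_pos⟩
    rw [h0] at h4
    have h5 : (0 : ℝ) < ((Module.finrank ℝ (Rn n) - 1 : ℕ) : ℝ) + 1 := by positivity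
    simp at h4
    linarith
  obtain ⟨r, hr⟩ := hu.exists
  exact hQ u r r.2 hr

/-! ### The two functionals -/

/-- The standing assumptions on `G`. -/
structure IsRadialDensity {n : ℕ} (G : ℝ → Sph n → ℝ) : Prop where
  continuousOn : ContinuousOn (fun p : ℝ × Sph n => G p.1 p.2) (Ici (0 : ℝ) ×ˢ univ)
  differentiableAt : ∀ t : ℝ, 0 < t → ∀ u : Sph n, DifferentiableAt ℝ (fun s : ℝ => G s u) t
  deriv_pos : ∀ t : ℝ, 0 < t → ∀ u : Sph n, 0 < deriv (fun s : ℝ => G s u) t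
  continuousOn_mul_deriv : ContinuousOn
    (fun p : ℝ × Sph n => p.1 * deriv (fun s : ℝ => G s p.2) p.1) (Ici (0 : ℝ) ×ˢ univ)

/-- The general dual volume `∫ G(ρ_K(u), u) du`. -/
noncomputable def dualVolume {n : ℕ} (G : ℝ → Sph n → ℝ) (K : ConvexBody (Rn n)) : ℝ :=
  ∫ u, G (radialFn (K : Set (Rn n)) (u : Rn n)) u ∂(sphereMeasure n)

/-- The primitive `t ↦ ∫₀ᵗ φ`. -/
noncomputable def primitive (φ : ℝ → ℝ) (t : ℝ) : ℝ := ∫ s in (0 : ℝ)..t, φ s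

/-- The Orlicz energy `∫ Φ(h_K) dμ`, where `Φ` is the primitive of `φ`. -/
noncomputable def orliczEnergy {n : ℕ} (φ : ℝ → ℝ) (μ : Measure (Sph n))
    (K : ConvexBody (Rn n)) : ℝ :=
  ∫ u : Sph n, primitive φ (supportFn (K : Set (Rn n)) (u : Rn n)) ∂μ

section Functionals

variable {n : ℕ} {G : ℝ → Sph n → ℝ}

theorem continuous_extend {F : ℝ × Sph n → ℝ} (hF : ContinuousOn F (Ici (0 : ℝ) ×ˢ univ)) :
    Continuous fun p : ℝ × Sph n => F (max p.1 0, p.2) :=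
  hF.comp_continuous (by fun_prop) fun p => ⟨le_max_right p.1 0, trivial⟩

theorem exists_bound_of_continuousOn {F : ℝ × Sph n → ℝ}
    (hF : ContinuousOn F (Ici (0 : ℝ) ×ˢ univ)) (R : ℝ) :
    ∃ M, 0 ≤ M ∧ ∀ t : ℝ, 0 ≤ t → t ≤ R → ∀ u : Sph n, |F (t, u)| ≤ M := by
  obtain ⟨M, hM⟩ := ((isCompact_Icc (a := (0 : ℝ)) (b := R)).prod isCompact_univ).exists_bound_of_continuousOn
    (hF.mono (prod_mono_left fun _ ht => ht.1))
  exact ⟨max M 0, le_max_right _ _, fun t h0 hR u =>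
    (hM (t, u) ⟨⟨h0, hR⟩, trivial⟩).trans (le_max_left _ _)⟩

theorem measurable_comp_radialFn {F : ℝ × Sph n → ℝ}
    (hF : ContinuousOn F (Ici (0 : ℝ) ×ˢ univ)) {K : ConvexBody (Rn n)} (h0 : 0 ∈ K) :
    Measurable fun u : Sph n => F (radialFn (K : Set (Rn n)) (u : Rn n), u) := by
  have h := (continuous_extend hF).measurable.comp ((measurable_radialFn h0).prodMk measurable_id)
  convert! h using 2 with u
  simp [max_eq_left (radialFn_nonneg K (u : Rn n))]

theorem exists_subset_closedBall (K : ConvexBody (Rn n)) :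
    ∃ R, 0 ≤ R ∧ (K : Set (Rn n)) ⊆ Metric.closedBall 0 R := by
  obtain ⟨R, hR⟩ := K.isBounded.subset_closedBall (0 : Rn n)
  exact ⟨max R 0, le_max_right _ _, hR.trans (Metric.closedBall_subset_closedBall (le_max_left _ _))⟩

theorem integrable_comp_radialFn {F : ℝ × Sph n → ℝ}
    (hF : ContinuousOn F (Ici (0 : ℝ) ×ˢ univ)) {K : ConvexBody (Rn n)} (h0 : 0 ∈ K) :
    Integrable (fun u : Sph n => F (radialFn (K : Set (Rn n)) (u : Rn n), u))
      (sphereMeasure n) := by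
  obtain ⟨R, hR0, hR⟩ := exists_subset_closedBall K
  obtain ⟨M, -, hM⟩ := exists_bound_of_continuousOn hF R
  exact Integrable.of_bound (measurable_comp_radialFn hF h0).aestronglyMeasurable M
    (Eventually.of_forall fun u => hM _ (radialFn_nonneg K _)
      (radialFn_le_of_subset_closedBall hR0 hR u) u)

namespace IsRadialDensity

theorem continuousOn_left (hG : IsRadialDensity G) (u : Sph n) :
    ContinuousOn (fun t => G t u) (Ici 0) :=
  hG.continuousOn.comp (f := fun t : ℝ => (t, u)) (by fun_prop) fun _ ht => ⟨ht, trivial⟩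

theorem strictMonoOn (hG : IsRadialDensity G) (u : Sph n) :
    StrictMonoOn (fun t => G t u) (Ici 0) :=
  strictMonoOn_of_deriv_pos (convex_Ici 0) (hG.continuousOn_left u) fun t ht =>
    hG.deriv_pos t (by simpa using ht) u

theorem integrable_radialFn (hG : IsRadialDensity G) {K : ConvexBody (Rn n)} (h0 : 0 ∈ K) :
    Integrable (fun u : Sph n => G (radialFn (K : Set (Rn n)) (u : Rn n)) u) (sphereMeasure n) :=
  integrable_comp_radialFn hG.continuousOn h0

end IsRadialDensity

variable {φ : ℝ → ℝ}

theorem hasDerivAt_primitive (hφ : Continuous φ) (t : ℝ) : HasDerivAt (primitive φ) (φ t) t :=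
  (hφ.integral_hasStrictDerivAt 0 t).hasDerivAt

theorem continuous_primitive (hφ : Continuous φ) : Continuous (primitive φ) :=
  continuous_iff_continuousAt.2 fun t => (hasDerivAt_primitive hφ t).continuousAt

theorem monotone_primitive (hφ : Continuous φ) (h : ∀ s, 0 ≤ φ s) : Monotone (primitive φ) :=
  monotone_of_deriv_nonneg (fun t => (hasDerivAt_primitive hφ t).differentiableAt) fun t => by
    rw [(hasDerivAt_primitive hφ t).deriv]; exact h t

theorem primitive_nonneg (hφ : Continuous φ) (h : ∀ s, 0 ≤ φ s) {t : ℝ} (ht : 0 ≤ t) :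
    0 ≤ primitive φ t := by
  simpa [primitive] using monotone_primitive hφ h ht

theorem integrable_of_continuous_sphere {μ : Measure (Sph n)} [IsFiniteMeasure μ]
    {f : Sph n → ℝ} (hf : Continuous f) : Integrable f μ :=
  (BoundedContinuousFunction.mkOfCompact ⟨f, hf⟩).integrable μ

theorem continuous_supportFn_sphere (K : ConvexBody (Rn n)) :
    Continuous fun u : Sph n => supportFn (K : Set (Rn n)) (u : Rn n) :=
  (continuous_supportFn K).comp continuous_subtype_val

/-! ### Existence of a minimiser -/

/-- If `μ` is not concentrated on a closed hemisphere, all closed caps of some fixed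
size have `μ`-measure bounded below. -/
theorem NotConcentratedOnClosedHemisphere.exists_le_measureReal {μ : Measure (Sph n)}
    [IsFiniteMeasure μ] (hμ : NotConcentratedOnClosedHemisphere μ) :
    ∃ δ > 0, ∃ ε > 0, ∀ v : Sph n,
      ε ≤ μ.real {u : Sph n | δ ≤ inner ℝ (u : Rn n) (v : Rn n)} := by
  have hc : Continuous fun v : Sph n =>
      ∫ u : Sph n, max (inner ℝ (u : Rn n) (v : Rn n)) 0 ∂μ := by
    refine continuous_of_dominated (bound := fun _ => 1) (fun v => ?_)
      (fun v => Eventually.of_forall fun u => ?_) (integrable_const _)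
      (Eventually.of_forall fun u => by fun_prop)
    · exact (by fun_prop : Continuous fun u : Sph n =>
        max (inner ℝ (u : Rn n) (v : Rn n) : ℝ) 0).aestronglyMeasurable
    · rw [Real.norm_of_nonneg (le_max_right _ _)]
      refine max_le ?_ zero_le_one
      simpa using real_inner_le_norm (u : Rn n) (v : Rn n)
  obtain ⟨m, hm0, hm⟩ : ∃ m > 0, ∀ v : Sph n,
      m ≤ ∫ u : Sph n, max (inner ℝ (u : Rn n) (v : Rn n)) 0 ∂μ := by
    rcases isEmpty_or_nonempty (Sph n) with he | he
    · exact ⟨1, one_pos, fun v => he.elim v⟩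
    · obtain ⟨v₀, -, h⟩ := isCompact_univ.exists_isMinOn univ_nonempty hc.continuousOn
      exact ⟨_, hμ v₀, fun v => h (mem_univ v)⟩
  have hT : 0 ≤ μ.real univ := measureReal_nonneg
  refine ⟨m / (2 * (μ.real univ + 1)), by positivity, m / 2, by positivity, fun v => ?_⟩
  set δ := m / (2 * (μ.real univ + 1)) with hδ
  set A := {u : Sph n | δ ≤ inner ℝ (u : Rn n) (v : Rn n)} with hA
  have hAm : MeasurableSet A :=
    (isClosed_le continuous_const (by fun_prop : Continuous fun u : Sph n =>
      (inner ℝ (u : Rn n) (v : Rn n) : ℝ))).measurableSet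
  have hδ0 : 0 < δ := by positivity
  have h1 : ∫ u : Sph n, max (inner ℝ (u : Rn n) (v : Rn n)) 0 ∂μ
      ≤ ∫ u : Sph n, (δ + A.indicator (fun _ => (1 : ℝ)) u) ∂μ := by
    refine integral_mono (integrable_of_continuous_sphere (by fun_prop))
      ((integrable_const _).add ((integrable_const _).indicator hAm)) fun u => ?_
    by_cases hu : u ∈ A
    · simp only [indicator_of_mem hu]
      have : inner ℝ (u : Rn n) (v : Rn n) ≤ 1 := by
        simpa using real_inner_le_norm (u : Rn n) (v : Rn n)
      exact max_le (by linarith) (by linarith)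
    · simp only [indicator_of_notMem hu, add_zero]
      exact max_le (not_le.1 hu).le hδ0.le
  rw [integral_add (integrable_const _) ((integrable_const _).indicator hAm), integral_const,
    integral_indicator_const _ hAm, smul_eq_mul, smul_eq_mul, mul_one] at h1
  have h2 : μ.real univ * δ ≤ m / 2 := by
    rw [hδ, mul_div_assoc', div_le_div_iff₀ (by positivity) two_pos]
    nlinarith
  linarith [hm v]

/-- Bodies of bounded Orlicz energy lie in a common ball. -/
theorem exists_subset_closedBall_of_orliczEnergy_le {μ : Measure (Sph n)} [IsFiniteMeasure μ]
    (hμ : NotConcentratedOnClosedHemisphere μ) (hφ : Continuous φ) (hφ0 : ∀ s, 0 ≤ φ s)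
    (hΦ : Tendsto (primitive φ) atTop atTop) (A : ℝ) :
    ∃ R, 0 ≤ R ∧ ∀ K : ConvexBody (Rn n), 0 ∈ K → orliczEnergy φ μ K ≤ A →
      (K : Set (Rn n)) ⊆ Metric.closedBall 0 R := by
  obtain ⟨δ, hδ, ε, hε, hcap⟩ := hμ.exists_le_measureReal
  obtain ⟨T, hT0, hT⟩ := ((eventually_ge_atTop 0).and (hΦ.eventually_gt_atTop (A / ε))).exists
  refine ⟨T / δ, by positivity, fun K h0 hK x hx => ?_⟩
  rw [mem_closedBall_zero_iff]
  by_contra! hlt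
  have hx0 : 0 < ‖x‖ := (by positivity : 0 ≤ T / δ).trans_lt hlt
  let v : Sph n := ⟨(‖x‖)⁻¹ • x, by simp [norm_smul, hx0.ne']⟩
  set B := {u : Sph n | δ ≤ inner ℝ (u : Rn n) (v : Rn n)} with hB
  have hBm : MeasurableSet B :=
    (isClosed_le continuous_const (by fun_prop : Continuous fun u : Sph n =>
      (inner ℝ (u : Rn n) (v : Rn n) : ℝ))).measurableSet
  have hTx : T ≤ ‖x‖ * δ := ((div_lt_iff₀ hδ).1 hlt).le
  have h1 : ∫ u : Sph n, B.indicator (fun _ => primitive φ T) u ∂μ ≤ orliczEnergy φ μ K := by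
    refine integral_mono ((integrable_const _).indicator hBm) (integrable_of_continuous_sphere
      ((continuous_primitive hφ).comp (continuous_supportFn_sphere K))) fun u => ?_
    by_cases hu : u ∈ B
    · simp only [indicator_of_mem hu]
      refine monotone_primitive hφ hφ0 ?_
      have h2 : inner ℝ (u : Rn n) x = ‖x‖ * inner ℝ (u : Rn n) (v : Rn n) := by
        simp only [v, inner_smul_right]
        rw [mul_inv_cancel_left₀ hx0.ne']
      calc T ≤ ‖x‖ * δ := hTx
        _ ≤ ‖x‖ * inner ℝ (u : Rn n) (v : Rn n) := mul_le_mul_of_nonneg_left hu hx0.le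
        _ = inner ℝ (u : Rn n) x := h2.symm
        _ ≤ _ := inner_le_supportFn hx _
    · simp only [indicator_of_notMem hu]
      exact primitive_nonneg hφ hφ0 (supportFn_nonneg h0 _)
  rw [integral_indicator_const _ hBm, smul_eq_mul] at h1
  have h3 : A < primitive φ T * ε := (div_lt_iff₀ hε).1 hT
  have h4 : primitive φ T * ε ≤ μ.real B * primitive φ T := by
    rw [mul_comm]
    exact mul_le_mul_of_nonneg_right (hcap v) (primitive_nonneg hφ hφ0 hT0)
  linarith

/-- A convex body without interior points has radial function zero in almost every direction. -/
theorem radialFn_ae_eq_zero {K : ConvexBody (Rn n)} (h0 : 0 ∈ K)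
    (hK : ¬ (interior (K : Set (Rn n))).Nonempty) :
    ∀ᵐ u : Sph n ∂(sphereMeasure n), radialFn (K : Set (Rn n)) (u : Rn n) = 0 := by
  have hnull : (volume : Measure (Rn n)) K = 0 := by
    refine measure_mono_null ?_ (K.convex.addHaar_frontier volume)
    rw [K.isClosed.frontier_eq, not_nonempty_iff_eq_empty.1 hK, sdiff_empty]
  have h1 : ∀ᵐ x ∂(volume : Measure (Rn n)), ∀ k : ℕ, ((k : ℝ) + 1)⁻¹ • x ∉ K := by
    refine ae_all_iff.2 fun k => ?_
    have hk : ((k : ℝ) + 1)⁻¹ ≠ 0 := by positivity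
    have : (volume : Measure (Rn n)) ((((k : ℝ) + 1)⁻¹ • ·) ⁻¹' (K : Set (Rn n))) = 0 := by
      rw [Measure.addHaar_preimage_smul _ hk, hnull, mul_zero]
    exact measure_eq_zero_iff_ae_notMem.1 this
  have h2 : ∀ᵐ x ∂(volume : Measure (Rn n)), ∀ t : ℝ, 0 < t → t • x ∉ K := by
    filter_upwards [h1] with x hx t ht htx
    obtain ⟨k, hk⟩ := exists_nat_one_div_lt ht
    refine hx k ?_
    have := smul_mem_of_le h0 htx (t := ((k : ℝ) + 1)⁻¹ / t) (by positivity)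
      ((div_le_one ht).2 (by rw [← one_div]; exact hk.le))
    rwa [smul_smul, div_mul_cancel₀ _ ht.ne'] at this
  filter_upwards [ae_sphere_of_ae h2 fun x t ht h s hs hm => h (s / t) (by positivity)
    (by rwa [smul_smul, div_mul_cancel₀ _ ht.ne'])] with u hu
  by_contra hne
  exact hu _ (lt_of_le_of_ne (radialFn_nonneg K _) (Ne.symm hne)) (radialMap_mem h0 u)

/-- Among the convex bodies containing the origin with at least the dual volume of the unit ball,
one has least Orlicz energy, and it has interior points. -/
theorem exists_minimizer [Nonempty (Sph n)] (hG : IsRadialDensity G) {μ : Measure (Sph n)}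
    [IsFiniteMeasure μ] (hμ : NotConcentratedOnClosedHemisphere μ) (hφ : Continuous φ)
    (hφ0 : ∀ s, 0 ≤ φ s) (hΦ : Tendsto (primitive φ) atTop atTop) :
    ∃ K : ConvexBody (Rn n), 0 ∈ K ∧ (interior (K : Set (Rn n))).Nonempty ∧
      ∀ L : ConvexBody (Rn n), 0 ∈ L → dualVolume G K ≤ dualVolume G L →
        orliczEnergy φ μ K ≤ orliczEnergy φ μ L := by
  let B : ConvexBody (Rn n) := ⟨Metric.closedBall 0 1, convex_closedBall _ _,
    isCompact_closedBall _ _, ⟨0, by simp⟩⟩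
  have hB0 : (0 : Rn n) ∈ B := Metric.mem_closedBall_self zero_le_one
  let A : Set (ConvexBody (Rn n)) := {K | 0 ∈ K ∧ dualVolume G B ≤ dualVolume G K}
  have hA : A.Nonempty := ⟨B, hB0, le_rfl⟩
  have hJ0 : ∀ K ∈ A, 0 ≤ orliczEnergy φ μ K := fun K hK =>
    integral_nonneg fun u => primitive_nonneg hφ hφ0 (supportFn_nonneg hK.1 _)
  have hbdd : BddBelow (orliczEnergy φ μ '' A) := ⟨0, by rintro _ ⟨K, hK, rfl⟩; exact hJ0 K hK⟩
  set m := sInf (orliczEnergy φ μ '' A) with hm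
  have hseq : ∀ i : ℕ, ∃ K ∈ A, orliczEnergy φ μ K < m + 1 / ((i : ℝ) + 1) := fun i => by
    obtain ⟨_, ⟨K, hK, rfl⟩, h⟩ := exists_lt_of_csInf_lt (hA.image (orliczEnergy φ μ))
      (lt_add_of_pos_right m (by positivity : (0 : ℝ) < 1 / ((i : ℝ) + 1)))
    exact ⟨K, hK, h⟩
  choose K hKA hKm using hseq
  obtain ⟨R, hR0, hR⟩ := exists_subset_closedBall_of_orliczEnergy_le hμ hφ hφ0 hΦ (m + 1)
  have hKR : ∀ i, (K i : Set (Rn n)) ⊆ Metric.closedBall 0 R := fun i =>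
    hR _ (hKA i).1 ((hKm i).le.trans (by
      have : 1 / ((i : ℝ) + 1) ≤ 1 := by
        rw [div_le_one (by positivity)]; linarith [(Nat.cast_nonneg i : (0 : ℝ) ≤ i)]
      linarith))
  obtain ⟨L, k, hk, hL⟩ := exists_subseq_tendsto_infDist K hKR
  have hk0 : ∀ i, 0 ∈ K (k i) := fun i => (hKA _).1
  have hL0 : 0 ∈ L := zero_mem_of_tendsto_infDist hk0 hL
  -- the dual volume is upper semicontinuous
  have hLV : dualVolume G B ≤ dualVolume G L := by
    by_contra! hlt
    obtain ⟨M, hM0, hM⟩ := exists_bound_of_continuousOn hG.continuousOn R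
    have h1 := eventually_lt_integral_of_liminf (m := sphereMeasure n)
      (f := fun u => -G (radialFn (L : Set (Rn n)) (u : Rn n)) u)
      (F := fun i u => -G (radialFn (K (k i) : Set (Rn n)) (u : Rn n)) u) (M := M)
      (a := -dualVolume G B)
      (hG.integrable_radialFn hL0).neg (fun i => (hG.integrable_radialFn (hk0 i)).neg)
      (fun i u => neg_le_neg ((le_abs_self _).trans (hM _ (radialFn_nonneg _ _)
        (radialFn_le_of_subset_closedBall hR0 (hKR _) u) u)))
      (Eventually.of_forall fun u c hc => ?_)
      (by rw [integral_neg]; exact neg_lt_neg hlt)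
    · obtain ⟨i, hi⟩ := h1.exists
      rw [integral_neg] at hi
      exact absurd (hKA (k i)).2 (not_le.2 (neg_lt_neg_iff.1 hi))
    · set r := radialFn (L : Set (Rn n)) (u : Rn n) with hr
      have hr0 : 0 ≤ r := radialFn_nonneg _ _
      have h2 : ∀ᶠ t in 𝓝[>] r, G t u < -c :=
        (((hG.continuousOn_left u) r hr0).mono (Ioi_subset_Ici hr0)).eventually_lt_const
          (by linarith)
      obtain ⟨t, ht, hrt⟩ := (h2.and self_mem_nhdsWithin).exists
      filter_upwards [eventually_radialFn_lt hk0 hL u hrt] with i hi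
      have := (hG.strictMonoOn u) (radialFn_nonneg (K (k i)) _) (hr0.trans hrt.le) hi
      simp only at this
      linarith
  -- the Orlicz energy is lower semicontinuous
  have hLJ : orliczEnergy φ μ L ≤ m := by
    by_contra! hlt
    obtain ⟨a, hma, haL⟩ := exists_between hlt
    have hint : ∀ K : ConvexBody (Rn n), Integrable
        (fun u : Sph n => primitive φ (supportFn (K : Set (Rn n)) (u : Rn n))) μ := fun K =>
      integrable_of_continuous_sphere ((continuous_primitive hφ).comp
        (continuous_supportFn_sphere K))
    have h1 := eventually_lt_integral_of_liminf (m := μ)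
      (F := fun i u => primitive φ (supportFn (K (k i) : Set (Rn n)) (u : Rn n))) (M := 0)
      (hint L) (fun i => hint _)
      (fun i u => by
        simpa using primitive_nonneg hφ hφ0 (supportFn_nonneg (hk0 i) (u : Rn n)))
      (Eventually.of_forall fun u c hc => ?_) haL
    · have h2 : Tendsto (fun i : ℕ => m + 1 / ((k i : ℝ) + 1)) atTop (𝓝 (m + 0)) :=
        tendsto_const_nhds.add (tendsto_one_div_add_atTop_nhds_zero_nat.comp hk.tendsto_atTop)
      rw [add_zero] at h2
      obtain ⟨i, hi, hi'⟩ := (h1.and (h2.eventually_lt_const hma)).exists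
      exact absurd (hi.trans (hKm (k i))) (not_lt.2 hi'.le)
    · have h2 : ∀ᶠ t in 𝓝[<] supportFn (L : Set (Rn n)) (u : Rn n), c < primitive φ t :=
        ((continuous_primitive hφ).tendsto _).mono_left nhdsWithin_le_nhds
          |>.eventually_const_lt hc
      obtain ⟨t, ht, htL⟩ := (h2.and self_mem_nhdsWithin).exists
      filter_upwards [eventually_lt_supportFn hL u htL] with i hi
      exact ht.trans_le (monotone_primitive hφ hφ0 hi.le)
  refine ⟨L, hL0, ?_, fun L' h0 h => hLJ.trans (csInf_le hbdd ⟨L', ⟨h0, hLV.trans h⟩, rfl⟩)⟩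
  by_contra hint
  have h1 : dualVolume G L = ∫ u, G 0 u ∂(sphereMeasure n) :=
    integral_congr_ae ((radialFn_ae_eq_zero hL0 hint).mono fun u hu => by
      simp only [hu])
  have h2 : ∀ u : Sph n, 1 ≤ radialFn (B : Set (Rn n)) (u : Rn n) := fun u =>
    le_radialFn zero_le_one (by
      change (1 : ℝ) • (u : Rn n) ∈ Metric.closedBall (0 : Rn n) 1
      simp)
  have h3 : ∀ u : Sph n, G 0 u < G (radialFn (B : Set (Rn n)) (u : Rn n)) u := fun u =>
    (hG.strictMonoOn u) self_mem_Ici (radialFn_nonneg B _) (zero_lt_one.trans_le (h2 u))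
  have h4 : Integrable (fun u => G 0 u) (sphereMeasure n) :=
    integrable_of_continuous_sphere (hG.continuousOn.comp_continuous (f := fun u => ((0 : ℝ), u))
      (by fun_prop) fun u => ⟨self_mem_Ici, trivial⟩)
  have h5 : ∫ u, G 0 u ∂(sphereMeasure n) < dualVolume G B := by
    have hp : 0 < ∫ u, (G (radialFn (B : Set (Rn n)) (u : Rn n)) u - G 0 u) ∂(sphereMeasure n) := by
      rw [integral_pos_iff_support_of_nonneg (fun u => (sub_pos.2 (h3 u)).le)
        ((hG.integrable_radialFn hB0).sub h4)]
      have : Function.support (fun u : Sph n =>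
          G (radialFn (B : Set (Rn n)) (u : Rn n)) u - G 0 u) = univ :=
        eq_univ_of_forall fun u => (sub_pos.2 (h3 u)).ne'
      rw [this]
      exact isOpen_univ.measure_pos _ univ_nonempty
    rw [integral_sub (hG.integrable_radialFn hB0) h4] at hp
    exact sub_pos.1 hp
  linarith

end Functionals

/-! ### Almost every radial direction has a unique normal -/

section Normals

open scoped Pointwise

variable {n : ℕ} {K : ConvexBody (Rn n)}

/-- If a ray from the origin meets the interior of `K`, every point of it slightly closer to the
origin is interior as well. -/
theorem smul_mem_interior_of_le {x : Rn n} (h0 : 0 ∈ K) (hx : x ∈ interior (K : Set (Rn n)))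
    {t : ℝ} (h : 0 < t) (h1 : t ≤ 1) : t • x ∈ interior (K : Set (Rn n)) := by
  have := K.convex.combo_interior_self_mem_interior hx (y := 0) h0 h (sub_nonneg.2 h1) (by ring)
  simpa using this

/-- The union of the open rays from the origin that meet `s`. -/
def openCone (s : Set (Rn n)) : Set (Rn n) := {x | ∃ t : ℝ, 0 < t ∧ t • x ∈ s}

theorem openCone_mono {s t : Set (Rn n)} (h : s ⊆ t) : openCone s ⊆ openCone t :=
  fun _ ⟨r, hr, hx⟩ => ⟨r, hr, h hx⟩

theorem smul_mem_openCone {s : Set (Rn n)} {x : Rn n} {t : ℝ} (ht : 0 < t) :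
    t • x ∈ openCone s ↔ x ∈ openCone s := by
  constructor
  · rintro ⟨r, hr, h⟩
    exact ⟨r * t, by positivity, by rwa [mul_smul]⟩
  · rintro ⟨r, hr, h⟩
    exact ⟨r / t, by positivity, by rwa [smul_smul, div_mul_cancel₀ _ ht.ne']⟩

theorem isOpen_openCone {s : Set (Rn n)} (hs : IsOpen s) : IsOpen (openCone s) := by
  have : openCone s = ⋃ t : ℝ, ⋃ _ : 0 < t, (fun x : Rn n => t • x) ⁻¹' s := by
    ext x; simp [openCone]
  rw [this]
  exact isOpen_iUnion fun t => isOpen_iUnion fun _ => hs.preimage (by fun_prop)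

theorem convex_openCone {s : Set (Rn n)} (hs : Convex ℝ s)
    (h : ∀ x ∈ s, ∀ t : ℝ, 0 < t → t ≤ 1 → t • x ∈ s) : Convex ℝ (openCone s) := by
  rintro x ⟨t, ht, hx⟩ y ⟨r, hr, hy⟩ a b ha hb hab
  have hm : 0 < min t r := lt_min ht hr
  refine ⟨min t r, hm, ?_⟩
  have h1 := h _ hx (min t r / t) (by positivity) ((div_le_one ht).2 (min_le_left _ _))
  have h2 := h _ hy (min t r / r) (by positivity) ((div_le_one hr).2 (min_le_right _ _))
  rw [smul_smul, div_mul_cancel₀ _ ht.ne'] at h1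
  rw [smul_smul, div_mul_cancel₀ _ hr.ne'] at h2
  have := hs h1 h2 ha hb hab
  rwa [smul_comm a, smul_comm b, ← smul_add] at this

theorem mem_openCone_iff (h0 : 0 ∈ K) {u : Sph n} :
    (u : Rn n) ∈ openCone (K : Set (Rn n)) ↔ 0 < radialFn (K : Set (Rn n)) (u : Rn n) :=
  ⟨fun ⟨_, ht, h⟩ => ht.trans_le (le_radialFn ht.le h), fun h => ⟨_, h, radialMap_mem h0 u⟩⟩

theorem convex_openCone_body (h0 : 0 ∈ K) : Convex ℝ (openCone (K : Set (Rn n))) :=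
  convex_openCone K.convex fun _ hx _ ht ht1 => smul_mem_of_le h0 hx ht.le ht1

theorem convex_openCone_interior (h0 : 0 ∈ K) :
    Convex ℝ (openCone (interior (K : Set (Rn n)))) :=
  convex_openCone K.convex.interior fun _ hx _ ht ht1 => smul_mem_interior_of_le h0 hx ht ht1

theorem interior_openCone_subset (hint : (interior (K : Set (Rn n))).Nonempty) :
    interior (openCone (K : Set (Rn n))) ⊆ openCone (interior (K : Set (Rn n))) := by
  intro x hx
  obtain ⟨z, hz⟩ := hint
  have hc : Tendsto (fun ε : ℝ => x - ε • z) (𝓝[>] 0) (𝓝 x) := by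
    have : ContinuousAt (fun ε : ℝ => x - ε • z) 0 := by fun_prop
    simpa [ContinuousAt] using this.tendsto.mono_left (nhdsWithin_le_nhds (s := Ioi 0))
  obtain ⟨ε, ⟨t, ht, htx⟩, hε⟩ :=
    ((hc.eventually (mem_interior_iff_mem_nhds.1 hx)).and self_mem_nhdsWithin).exists
  have hε0 : 0 < ε := hε
  have h1 := K.convex.combo_self_interior_mem_interior htx hz
    (a := 1 / (1 + t * ε)) (b := t * ε / (1 + t * ε)) (by positivity) (by positivity)
    (by rw [← add_div]; exact div_self (by positivity))
  refine ⟨t / (1 + t * ε), by positivity, ?_⟩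
  convert h1 using 1
  rw [smul_sub, smul_sub, smul_smul, smul_smul, smul_smul, sub_add_eq_add_sub, eq_sub_iff_add_eq]
  congr 2 <;> ring

theorem ae_mem_openCone_interior_or (h0 : 0 ∈ K) (hint : (interior (K : Set (Rn n))).Nonempty) :
    ∀ᵐ x ∂(volume : Measure (Rn n)), x ∈ openCone (interior (K : Set (Rn n))) ∨
      x ∉ openCone (K : Set (Rn n)) := by
  have h := (convex_openCone_body h0).addHaar_frontier volume
  filter_upwards [measure_eq_zero_iff_ae_notMem.1 h] with x hx
  by_contra! hc
  exact hx ⟨subset_closure hc.2, fun hi => hc.1 (interior_openCone_subset hint hi)⟩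

theorem exists_lt_of_gauge_lt_of_mem_openCone {x : Rn n} (hx : x ∈ openCone (K : Set (Rn n)))
    {a : ℝ} (ha : gauge (K : Set (Rn n)) x < a) :
    ∃ b, 0 < b ∧ b < a ∧ ∃ y ∈ K, x = b • y := by
  have hne : {r : ℝ | r ∈ Ioi (0 : ℝ) ∧ x ∈ r • (K : Set (Rn n))}.Nonempty := by
    obtain ⟨t, ht, hx⟩ := hx
    exact ⟨t⁻¹, inv_pos.2 ht, ⟨_, hx, inv_smul_smul₀ ht.ne' x⟩⟩
  obtain ⟨b, ⟨hb, y, hy, hxy⟩, hba⟩ := exists_lt_of_csInf_lt hne ha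
  exact ⟨b, hb, hba, y, hy, hxy.symm⟩

theorem gauge_add_le_of_mem_openCone {x y : Rn n} (hx : x ∈ openCone (K : Set (Rn n)))
    (hy : y ∈ openCone (K : Set (Rn n))) :
    gauge (K : Set (Rn n)) (x + y) ≤ gauge (K : Set (Rn n)) x + gauge (K : Set (Rn n)) y := by
  refine le_of_forall_pos_le_add fun ε hε => ?_
  obtain ⟨a, ha, hax, x', hx', rfl⟩ :=
    exists_lt_of_gauge_lt_of_mem_openCone hx (lt_add_of_pos_right _ (half_pos hε))
  obtain ⟨b, hb, hby, y', hy', rfl⟩ :=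
    exists_lt_of_gauge_lt_of_mem_openCone hy (lt_add_of_pos_right _ (half_pos hε))
  have hab : 0 < a + b := add_pos ha hb
  have h1 := K.convex hx' hy' (a := a / (a + b)) (b := b / (a + b)) (by positivity)
    (by positivity) (by rw [← add_div]; exact div_self hab.ne')
  have h2 : gauge (K : Set (Rn n)) (a • x' + b • y') ≤ a + b := by
    refine gauge_le_of_mem hab.le ⟨_, h1, ?_⟩
    simp only [smul_add, smul_smul]
    rw [mul_div_cancel₀ _ hab.ne', mul_div_cancel₀ _ hab.ne']
  linarith

theorem convexOn_gauge (h0 : 0 ∈ K) :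
    ConvexOn ℝ (openCone (interior (K : Set (Rn n)))) (gauge (K : Set (Rn n))) := by
  refine convexOn_iff_forall_pos.2 ⟨convex_openCone_interior h0, fun x hx y hy a b ha hb _ => ?_⟩
  have hsub := openCone_mono (interior_subset (s := (K : Set (Rn n))))
  refine (gauge_add_le_of_mem_openCone ((smul_mem_openCone ha).2 (hsub hx))
    ((smul_mem_openCone hb).2 (hsub hy))).trans_eq ?_
  rw [gauge_smul_of_nonneg ha.le, gauge_smul_of_nonneg hb.le]

/-- The gauge is convex, hence locally Lipschitz, on the cone over the interior, so it is
differentiable almost everywhere there by Rademacher's theorem. -/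
theorem ae_differentiableAt_gauge (h0 : 0 ∈ K) :
    ∀ᵐ x ∂(volume : Measure (Rn n)), x ∈ openCone (interior (K : Set (Rn n))) →
      DifferentiableAt ℝ (gauge (K : Set (Rn n))) x := by
  have hopen : IsOpen (openCone (interior (K : Set (Rn n)))) := isOpen_openCone isOpen_interior
  have hlip := (convexOn_gauge h0).locallyLipschitzOn hopen
  have hnull : (volume : Measure (Rn n)) {x | ¬ (x ∈ openCone (interior (K : Set (Rn n))) →
      DifferentiableAt ℝ (gauge (K : Set (Rn n))) x)} = 0 := by
    refine measure_null_of_locally_null _ fun x hx => ?_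
    have hxc : x ∈ openCone (interior (K : Set (Rn n))) := by
      by_contra h
      exact hx fun h' => absurd h' h
    obtain ⟨C, t, ht, hCt⟩ := hlip hxc
    rw [hopen.nhdsWithin_eq hxc] at ht
    obtain ⟨s, hst, hs, hxs⟩ := mem_nhds_iff.1 ht
    refine ⟨s ∩ _, inter_mem (mem_nhdsWithin_of_mem_nhds (hs.mem_nhds hxs)) self_mem_nhdsWithin, ?_⟩
    refine measure_eq_zero_iff_ae_notMem.2 ?_
    filter_upwards [(hCt.mono hst).ae_differentiableWithinAt_of_mem (μ := volume)] with y hy hys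
    exact hys.2 fun _ => (hy hys.1).differentiableAt (hs.mem_nhds hys.1)
  exact ae_iff.2 hnull

/-- The radial Gauss map `α_K`: the normalised gradient of the gauge of `K`. It is the outer
unit normal at `ρ_K(u) u` wherever that normal is unique; its value elsewhere is irrelevant. -/
noncomputable def radialGauss (K : ConvexBody (Rn n)) (u : Sph n) : Sph n :=
  open Classical in
  if h : (InnerProductSpace.toDual ℝ (Rn n)).symm (fderiv ℝ (gauge (K : Set (Rn n))) (u : Rn n)) = 0
  then u else
  ⟨(‖(InnerProductSpace.toDual ℝ (Rn n)).symm (fderiv ℝ (gauge (K : Set (Rn n))) (u : Rn n))‖)⁻¹ •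
    (InnerProductSpace.toDual ℝ (Rn n)).symm (fderiv ℝ (gauge (K : Set (Rn n))) (u : Rn n)), by
      simpa [norm_smul] using inv_mul_cancel₀ (norm_ne_zero_iff.2 (by simpa using h))⟩

theorem measurable_radialGauss (K : ConvexBody (Rn n)) : Measurable (radialGauss K) := by
  classical
  have hg : Measurable fun u : Sph n => (InnerProductSpace.toDual ℝ (Rn n)).symm
      (fderiv ℝ (gauge (K : Set (Rn n))) (u : Rn n)) :=
    (InnerProductSpace.toDual ℝ (Rn n)).symm.continuous.measurable.comp
      ((measurable_fderiv ℝ _).comp measurable_subtype_coe)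
  have hval : Measurable fun u : Sph n => ((radialGauss K u : Sph n) : Rn n) := by
    have : (fun u : Sph n => ((radialGauss K u : Sph n) : Rn n)) = fun u : Sph n =>
        if (InnerProductSpace.toDual ℝ (Rn n)).symm
          (fderiv ℝ (gauge (K : Set (Rn n))) (u : Rn n)) = 0 then (u : Rn n) else
        (‖(InnerProductSpace.toDual ℝ (Rn n)).symm
          (fderiv ℝ (gauge (K : Set (Rn n))) (u : Rn n))‖)⁻¹ •
          (InnerProductSpace.toDual ℝ (Rn n)).symm
            (fderiv ℝ (gauge (K : Set (Rn n))) (u : Rn n)) := by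
      ext1 u
      unfold radialGauss
      split_ifs <;> rfl
    rw [this]
    exact Measurable.ite (hg (measurableSet_singleton 0)) measurable_subtype_coe
      (hg.norm.inv.smul hg)
  exact hval.subtype_mk (h := fun u => (radialGauss K u).2)

/-- A direction is regular if the boundary point `ρ_K(u) u` is not the origin and has a unique
outer unit normal, given by `radialGauss K u`, whose supporting hyperplane misses the origin. -/
structure IsRegularDirection (K : ConvexBody (Rn n)) (u : Sph n) : Prop where
  radialFn_pos : 0 < radialFn (K : Set (Rn n)) (u : Rn n)
  supportFn_pos : 0 < supportFn (K : Set (Rn n)) (radialGauss K u : Rn n)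
  normal_iff : ∀ v : Sph n, radialFn (K : Set (Rn n)) (u : Rn n) * inner ℝ (v : Rn n) (u : Rn n) =
    supportFn (K : Set (Rn n)) (v : Rn n) ↔ v = radialGauss K u

theorem supportFn_pos_of_mem_openCone_interior (h0 : 0 ∈ K) {u v : Sph n}
    (hu : (u : Rn n) ∈ openCone (interior (K : Set (Rn n))))
    (hv : radialFn (K : Set (Rn n)) (u : Rn n) * inner ℝ (v : Rn n) (u : Rn n) =
      supportFn (K : Set (Rn n)) (v : Rn n)) :
    0 < supportFn (K : Set (Rn n)) (v : Rn n) := by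
  have hρ := (mem_openCone_iff h0).1 (openCone_mono interior_subset hu)
  obtain ⟨t, ht, h⟩ := hu
  refine lt_of_le_of_ne (supportFn_nonneg h0 _) fun hne => ?_
  have h1 := (mem_interior_iff_forall_inner_lt K).1 h v
  rw [← hne] at hv h1
  rw [inner_smul_right, (mul_eq_zero.1 hv).resolve_left hρ.ne', mul_zero] at h1
  exact lt_irrefl _ h1

theorem gauge_eq_inv_radialFn (h0 : 0 ∈ K) {u : Sph n}
    (hu : (u : Rn n) ∈ openCone (K : Set (Rn n))) :
    gauge (K : Set (Rn n)) (u : Rn n) = (radialFn (K : Set (Rn n)) (u : Rn n))⁻¹ := by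
  have hρ := (mem_openCone_iff h0).1 hu
  refine le_antisymm (gauge_le_of_mem (inv_nonneg.2 hρ.le)
    ⟨_, radialMap_mem h0 u, inv_smul_smul₀ hρ.ne' _⟩) (le_of_forall_gt fun a ha => ?_)
  obtain ⟨b, hb, hba, y, hy, huy⟩ := exists_lt_of_gauge_lt_of_mem_openCone hu ha
  refine lt_of_le_of_lt ?_ hba
  rw [inv_le_comm₀ hρ hb]
  refine le_radialFn (inv_nonneg.2 hb.le) ?_
  rw [huy, inv_smul_smul₀ hb.ne']
  exact hy

/-- At a point where the gauge is differentiable, every outer normal is proportional to its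
gradient: the linear function defined by the normal supports the gauge from below there. -/
theorem eq_radialGauss_of_differentiableAt (h0 : 0 ∈ K) {u v : Sph n}
    (hu : (u : Rn n) ∈ openCone (interior (K : Set (Rn n))))
    (hd : DifferentiableAt ℝ (gauge (K : Set (Rn n))) (u : Rn n))
    (hv : radialFn (K : Set (Rn n)) (u : Rn n) * inner ℝ (v : Rn n) (u : Rn n) =
      supportFn (K : Set (Rn n)) (v : Rn n)) : v = radialGauss K u := by
  have hP := openCone_mono interior_subset hu
  have hρ := (mem_openCone_iff h0).1 hP
  have hh := supportFn_pos_of_mem_openCone_interior h0 hu hv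
  set c := supportFn (K : Set (Rn n)) (v : Rn n) with hc
  let ℓ : Rn n →L[ℝ] ℝ := c⁻¹ • InnerProductSpace.toDual ℝ (Rn n) (v : Rn n)
  have hℓ : ∀ y, ℓ y = c⁻¹ * inner ℝ (v : Rn n) y := fun y => by simp [ℓ]
  have hmin : IsLocalMin (fun y => gauge (K : Set (Rn n)) y - ℓ y) (u : Rn n) := by
    have hval : gauge (K : Set (Rn n)) (u : Rn n) - ℓ u = 0 := by
      rw [hℓ, gauge_eq_inv_radialFn h0 hP, ← hv]
      have : (inner ℝ (v : Rn n) (u : Rn n) : ℝ) ≠ 0 := fun h => by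
        rw [h, mul_zero] at hv; exact hh.ne hv
      field_simp
      ring
    filter_upwards [(isOpen_openCone isOpen_interior).mem_nhds hu] with y hy
    rw [hval, sub_nonneg]
    refine le_of_forall_gt fun a ha => ?_
    obtain ⟨b, hb, hba, z, hz, rfl⟩ :=
      exists_lt_of_gauge_lt_of_mem_openCone (openCone_mono interior_subset hy) ha
    refine lt_of_le_of_lt ?_ hba
    rw [hℓ, inner_smul_right, inv_mul_le_iff₀ hh, mul_comm c]
    exact mul_le_mul_of_nonneg_left (inner_le_supportFn hz _) hb.le
  have hf : fderiv ℝ (gauge (K : Set (Rn n))) (u : Rn n) = ℓ := by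
    have := hmin.fderiv_eq_zero
    rw [fderiv_fun_sub hd ℓ.differentiableAt, ℓ.fderiv] at this
    exact sub_eq_zero.1 this
  have hgrad : (InnerProductSpace.toDual ℝ (Rn n)).symm
      (fderiv ℝ (gauge (K : Set (Rn n))) (u : Rn n)) = c⁻¹ • (v : Rn n) := by
    rw [hf]; simp [ℓ]
  have hvn : ‖(v : Rn n)‖ = 1 := by simp
  have hv0 : (v : Rn n) ≠ 0 := norm_ne_zero_iff.1 (by rw [hvn]; exact one_ne_zero)
  ext1
  unfold radialGauss
  rw [dif_neg (by rw [hgrad]; exact smul_ne_zero (inv_ne_zero hh.ne') hv0)]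
  simp only [hgrad]
  rw [norm_smul, hvn, mul_one, norm_inv, Real.norm_of_nonneg hh.le, inv_inv, smul_smul,
    mul_inv_cancel₀ hh.ne', one_smul]

theorem ae_isRegularDirection_or (h0 : 0 ∈ K) (hint : (interior (K : Set (Rn n))).Nonempty) :
    ∀ᵐ u : Sph n ∂(sphereMeasure n), IsRegularDirection K u ∨
      radialFn (K : Set (Rn n)) (u : Rn n) = 0 := by
  have h1 := ae_sphere_of_ae (ae_mem_openCone_interior_or h0 hint) fun x t ht h => by
    simpa only [smul_mem_openCone ht] using h
  have h2 := ae_sphere_of_ae (ae_differentiableAt_gauge h0) fun x t ht h hx => by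
    have hd := h ((smul_mem_openCone ht).2 hx)
    have heq : gauge (K : Set (Rn n)) =
        fun y => t⁻¹ * gauge (K : Set (Rn n)) (t • y) := by
      ext y
      rw [gauge_smul_of_nonneg ht.le, smul_eq_mul, inv_mul_cancel_left₀ ht.ne']
    rw [heq]
    exact (hd.comp x (differentiableAt_id.const_smul t)).const_mul _
  filter_upwards [h1, h2] with u hu hd
  rcases hu with hu | hu
  · left
    have hρ := (mem_openCone_iff h0).1 (openCone_mono interior_subset hu)
    obtain ⟨v, hv⟩ := exists_normal_radialMap h0 u
    have hva := eq_radialGauss_of_differentiableAt h0 hu (hd hu) hv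
    refine ⟨hρ, hva ▸ supportFn_pos_of_mem_openCone_interior h0 hu hv, fun w =>
      ⟨fun hw => eq_radialGauss_of_differentiableAt h0 hu (hd hu) hw, fun hw => ?_⟩⟩
    rw [hw, ← hva, hv]
  · right
    rw [mem_openCone_iff h0, not_lt] at hu
    exact le_antisymm hu (radialFn_nonneg K _)

end Normals

/-! ### The dual curvature measure as a push-forward -/

section Curvature

variable {n : ℕ} {K : ConvexBody (Rn n)} {G : ℝ → Sph n → ℝ}

/-- The density `ρ_K(u) G_t(ρ_K(u), u)`. -/
noncomputable def radialDensity (G : ℝ → Sph n → ℝ) (K : ConvexBody (Rn n)) (u : Sph n) : ℝ :=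
  radialFn (K : Set (Rn n)) (u : Rn n) *
    deriv (fun t : ℝ => G t u) (radialFn (K : Set (Rn n)) (u : Rn n))

namespace IsRadialDensity

theorem measurable_radialDensity (hG : IsRadialDensity G) (h0 : 0 ∈ K) :
    Measurable (radialDensity G K) :=
  measurable_comp_radialFn hG.continuousOn_mul_deriv h0

theorem integrable_radialDensity (hG : IsRadialDensity G) (h0 : 0 ∈ K) :
    Integrable (radialDensity G K) (sphereMeasure n) :=
  integrable_comp_radialFn hG.continuousOn_mul_deriv h0

theorem radialDensity_nonneg (hG : IsRadialDensity G) (u : Sph n) : 0 ≤ radialDensity G K u := by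
  rcases (radialFn_nonneg K (u : Rn n)).eq_or_lt with h | h
  · rw [radialDensity, ← h, zero_mul]
  · exact mul_nonneg h.le (hG.deriv_pos _ h u).le

theorem radialDensity_pos (hG : IsRadialDensity G) {u : Sph n}
    (h : 0 < radialFn (K : Set (Rn n)) (u : Rn n)) : 0 < radialDensity G K u :=
  mul_pos h (hG.deriv_pos _ h u)

end IsRadialDensity

theorem radialDensity_eq_zero {u : Sph n} (h : radialFn (K : Set (Rn n)) (u : Rn n) = 0) :
    radialDensity G K u = 0 := by rw [radialDensity, h, zero_mul]

theorem mem_reverseRadialSphericalImage_iff (h0 : 0 ∈ K) {E : Set (Sph n)} {u : Sph n} :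
    u ∈ reverseRadialSphericalImage (K : Set (Rn n)) E ↔
      ∃ v ∈ E, radialFn (K : Set (Rn n)) (u : Rn n) * inner ℝ (v : Rn n) (u : Rn n) =
        supportFn (K : Set (Rn n)) (v : Rn n) := by
  have hm := radialMap_mem h0 u
  simp only [reverseRadialSphericalImage, reverseSphericalImage, mem_preimage, mem_ofPred_eq,
    radialMap, mem_frontier_iff, mem_normalCone_iff K hm, inner_smul_right]
  exact ⟨fun ⟨_, h⟩ => h, fun ⟨v, hv, h⟩ => ⟨⟨hm, v, h⟩, v, hv, h⟩⟩

theorem dualCurvature_eq_setIntegral (h0 : 0 ∈ K) (hint : (interior (K : Set (Rn n))).Nonempty)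
    {E : Set (Sph n)} (hE : MeasurableSet E) :
    dualCurvature G (K : Set (Rn n)) E =
      (1 / (n : ℝ)) * ∫ u in radialGauss K ⁻¹' E, radialDensity G K u ∂(sphereMeasure n) := by
  have hmeas : MeasurableSet (radialGauss K ⁻¹' E) := measurable_radialGauss K hE
  have hpos : MeasurableSet {u : Sph n | 0 < radialFn (K : Set (Rn n)) (u : Rn n)} :=
    measurableSet_lt measurable_const (measurable_radialFn h0)
  have h1 : reverseRadialSphericalImage (K : Set (Rn n)) (E \ unitNormals (K : Set (Rn n)))
      =ᵐ[sphereMeasure n] (radialGauss K ⁻¹' E ∩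
        {u : Sph n | 0 < radialFn (K : Set (Rn n)) (u : Rn n)} : Set (Sph n)) := by
    refine eventuallyEq_set.2 ?_
    filter_upwards [ae_isRegularDirection_or h0 hint] with u hu
    rw [mem_reverseRadialSphericalImage_iff h0]
    rcases hu with hu | hu
    · constructor
      · rintro ⟨v, hv, hvu⟩
        rw [hu.normal_iff] at hvu
        exact ⟨by rw [mem_preimage, ← hvu]; exact hv.1, hu.radialFn_pos⟩
      · rintro ⟨h, -⟩
        refine ⟨_, ⟨h, fun hn => ?_⟩, (hu.normal_iff _).2 rfl⟩
        exact hu.supportFn_pos.ne' ((mem_unitNormals_iff K h0).1 hn)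
    · constructor
      · rintro ⟨v, hv, hvu⟩
        rw [hu, zero_mul] at hvu
        exact absurd ((mem_unitNormals_iff K h0).2 hvu.symm) hv.2
      · rintro ⟨-, h⟩
        exact absurd hu (ne_of_gt h)
  unfold dualCurvature
  rw [setIntegral_congr_set h1]
  congr 1
  refine (setIntegral_eq_of_subset_of_forall_sdiff_eq_zero hmeas inter_subset_left ?_).symm
  rintro u ⟨hu, hu'⟩
  have : radialFn (K : Set (Rn n)) (u : Rn n) = 0 :=
    le_antisymm (not_lt.1 fun h => hu' ⟨hu, h⟩) (radialFn_nonneg K _)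
  exact radialDensity_eq_zero this

end Curvature

/-! ### First variation of the dual volume and of the Orlicz energy -/

section Variation

variable {n : ℕ} {K : ConvexBody (Rn n)} {G : ℝ → Sph n → ℝ} {g : Sph n → ℝ} {M : ℝ}

/-- The Wulff shape of `h_K + t g`, truncated at `0` so that it always contains the origin. -/
noncomputable def perturb (K : ConvexBody (Rn n)) (g : Sph n → ℝ) (hg : Continuous g) (t : ℝ) :
    ConvexBody (Rn n) :=
  wulffShape (fun v => max (supportFn (K : Set (Rn n)) (v : Rn n) + t * g v) 0)
    (fun _ => le_max_right _ _)
    (((continuous_supportFn_sphere K).add (continuous_const.mul hg)).max continuous_const)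

theorem zero_mem_perturb {hg : Continuous g} {t : ℝ} : 0 ∈ perturb K g hg t :=
  zero_mem_wulffShape

theorem mem_perturb_of_forall {hg : Continuous g} {t : ℝ} {x : Rn n}
    (h : ∀ v : Sph n, inner ℝ (v : Rn n) x ≤ supportFn (K : Set (Rn n)) (v : Rn n) + t * g v) :
    x ∈ perturb K g hg t :=
  fun v => (h v).trans (le_max_left _ _)

/-- The bound `g ≥ -M h_K` keeps `h_K + t g` nonnegative for small `t`. -/
theorem sub_mul_supportFn_le (hgM : ∀ v : Sph n, -(M * supportFn (K : Set (Rn n)) (v : Rn n)) ≤ g v)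
    {t : ℝ} (ht : 0 ≤ t) (v : Sph n) :
    (1 - t * M) * supportFn (K : Set (Rn n)) (v : Rn n) ≤
      supportFn (K : Set (Rn n)) (v : Rn n) + t * g v := by
  nlinarith [mul_le_mul_of_nonneg_left (hgM v) ht]

theorem mul_radialFn_le_radialFn_perturb (h0 : 0 ∈ K) {hg : Continuous g}
    (hgM : ∀ v : Sph n, -(M * supportFn (K : Set (Rn n)) (v : Rn n)) ≤ g v)
    {t : ℝ} (ht : 0 ≤ t) (htM : t * M ≤ 1) (u : Sph n) :
    (1 - t * M) * radialFn (K : Set (Rn n)) (u : Rn n) ≤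
      radialFn (perturb K g hg t : Set (Rn n)) (u : Rn n) := by
  refine le_radialFn (mul_nonneg (sub_nonneg.2 htM) (radialFn_nonneg K _))
    (mem_perturb_of_forall fun v => ?_)
  refine le_trans ?_ (sub_mul_supportFn_le hgM ht v)
  rw [mul_smul, inner_smul_right]
  exact mul_le_mul_of_nonneg_left (inner_le_supportFn (radialMap_mem h0 u) _) (sub_nonneg.2 htM)

/-- The one-sided Alexandrov variational formula for the radial function at a regular direction.
Away from the unique normal the constraints of the Wulff shape have uniform slack, and near it
the comparison of first-order terms decides. -/
theorem IsRegularDirection.eventually_le_radialFn_perturb {u : Sph n}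
    (hu : IsRegularDirection K u) (h0 : 0 ∈ K) (hg : Continuous g) {c : ℝ}
    (hc : c < g (radialGauss K u) / supportFn (K : Set (Rn n)) (radialGauss K u : Rn n)) :
    ∀ᶠ t in 𝓝[>] (0 : ℝ), radialFn (K : Set (Rn n)) (u : Rn n) * (1 + t * c) ≤
      radialFn (perturb K g hg t : Set (Rn n)) (u : Rn n) := by
  set ρ := radialFn (K : Set (Rn n)) (u : Rn n) with hρ
  have hcont := continuous_supportFn_sphere K
  have key : ∀ᶠ t in 𝓝 (0 : ℝ), ∀ v ∈ (univ : Set (Sph n)), 0 < t →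
      ρ * (1 + t * c) * inner ℝ (v : Rn n) (u : Rn n) ≤
        supportFn (K : Set (Rn n)) (v : Rn n) + t * g v := by
    refine isCompact_univ.eventually_forall_of_forall_eventually fun v _ => ?_
    have hin : Continuous fun z : ℝ × Sph n => (inner ℝ (z.2 : Rn n) (u : Rn n) : ℝ) := by fun_prop
    by_cases hv : v = radialGauss K u
    · have h1 : c * (ρ * inner ℝ (v : Rn n) (u : Rn n)) < g v := by
        rw [(hu.normal_iff v).2 hv, hv]
        exact (lt_div_iff₀ hu.supportFn_pos).1 hc
      have hlt : ∀ᶠ z : ℝ × Sph n in 𝓝 (0, v),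
          c * (ρ * inner ℝ (z.2 : Rn n) (u : Rn n)) < g z.2 :=
        ((continuous_const.mul (continuous_const.mul hin)).continuousAt).eventually_lt
          (hg.comp continuous_snd).continuousAt h1
      filter_upwards [hlt] with z hz hz0
      have h2 := inner_radialMap_le h0 u z.2
      nlinarith [mul_lt_mul_of_pos_left hz hz0]
    · have h1 : ρ * inner ℝ (v : Rn n) (u : Rn n) < supportFn (K : Set (Rn n)) (v : Rn n) :=
        lt_of_le_of_ne (inner_radialMap_le h0 u v) fun h => hv ((hu.normal_iff v).1 h)
      have hl : Continuous fun z : ℝ × Sph n =>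
          ρ * (1 + z.1 * c) * (inner ℝ (z.2 : Rn n) (u : Rn n) : ℝ) := by fun_prop
      have hr : Continuous fun z : ℝ × Sph n =>
          supportFn (K : Set (Rn n)) (z.2 : Rn n) + z.1 * g z.2 :=
        (hcont.comp continuous_snd).add (continuous_fst.mul (hg.comp continuous_snd))
      have hlt : ∀ᶠ z : ℝ × Sph n in 𝓝 (0, v),
          ρ * (1 + z.1 * c) * (inner ℝ (z.2 : Rn n) (u : Rn n) : ℝ) <
            supportFn (K : Set (Rn n)) (z.2 : Rn n) + z.1 * g z.2 :=
        hl.continuousAt.eventually_lt hr.continuousAt (by simpa using h1)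
      filter_upwards [hlt] with z hz _
      exact hz.le
  have hnn : ∀ᶠ t in 𝓝 (0 : ℝ), 0 ≤ ρ * (1 + t * c) := by
    have : Continuous fun t : ℝ => ρ * (1 + t * c) := by fun_prop
    have h1 : (0 : ℝ) < ρ * (1 + 0 * c) := by simpa using hu.radialFn_pos
    exact (this.continuousAt.eventually_const_lt h1).mono fun _ h => h.le
  filter_upwards [key.filter_mono nhdsWithin_le_nhds, hnn.filter_mono nhdsWithin_le_nhds,
    self_mem_nhdsWithin] with t ht htn ht0
  refine le_radialFn htn (mem_perturb_of_forall fun v => ?_)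
  rw [inner_smul_right]
  exact ht v trivial ht0

theorem IsRegularDirection.eventually_lt_slope {u : Sph n} (hu : IsRegularDirection K u)
    (hG : IsRadialDensity G) (h0 : 0 ∈ K) (hg : Continuous g) {c : ℝ}
    (hc : c < radialDensity G K u *
      (g (radialGauss K u) / supportFn (K : Set (Rn n)) (radialGauss K u : Rn n))) :
    ∀ᶠ t in 𝓝[>] (0 : ℝ), c < (G (radialFn (perturb K g hg t : Set (Rn n)) (u : Rn n)) u -
      G (radialFn (K : Set (Rn n)) (u : Rn n)) u) / t := by
  have hD := hG.radialDensity_pos hu.radialFn_pos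
  rw [mul_comm, ← div_lt_iff₀ hD] at hc
  obtain ⟨c', hcc', hc'⟩ := exists_between hc
  rw [div_lt_iff₀ hD] at hcc'
  set ρ := radialFn (K : Set (Rn n)) (u : Rn n) with hρ
  have hder : HasDerivAt (fun t : ℝ => G (ρ * (1 + t * c')) u) (c' * radialDensity G K u) 0 := by
    have h1 : HasDerivAt (fun t : ℝ => ρ * (1 + t * c')) (ρ * c') 0 := by
      have := ((hasDerivAt_id (0 : ℝ)).mul_const c').const_add 1 |>.const_mul ρ
      simpa using this
    have h2 : HasDerivAt (fun s : ℝ => G s u) (deriv (fun s : ℝ => G s u) ρ) (ρ * (1 + 0 * c')) := by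
      simpa using (hG.differentiableAt ρ hu.radialFn_pos u).hasDerivAt
    have h3 := h2.comp (0 : ℝ) h1
    refine h3.congr_deriv ?_
    rw [radialDensity, ← hρ]
    ring
  have hsl := (hasDerivAt_iff_tendsto_slope.1 hder).mono_left
    (nhdsWithin_mono 0 fun t (ht : t ∈ Ioi (0 : ℝ)) => (ne_of_gt ht : t ≠ 0))
  have hnn : ∀ᶠ t in 𝓝 (0 : ℝ), 0 ≤ ρ * (1 + t * c') := by
    have : Continuous fun t : ℝ => ρ * (1 + t * c') := by fun_prop
    have h1 : (0 : ℝ) < ρ * (1 + 0 * c') := by simpa using hu.radialFn_pos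
    exact (this.continuousAt.eventually_const_lt h1).mono fun _ h => h.le
  filter_upwards [hsl.eventually_const_lt hcc', hu.eventually_le_radialFn_perturb h0 hg hc',
    hnn.filter_mono nhdsWithin_le_nhds, self_mem_nhdsWithin] with t ht1 ht2 ht3 ht0
  refine ht1.trans_le ?_
  rw [slope_def_field, sub_zero]
  simp only [zero_mul, add_zero, mul_one]
  exact div_le_div_of_nonneg_right (sub_le_sub_right
    ((hG.strictMonoOn u).monotoneOn ht3 (radialFn_nonneg _ _) ht2) _) (le_of_lt ht0)

/-- The difference quotients of the dual volume are bounded below. -/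
theorem IsRadialDensity.exists_le_slope (hG : IsRadialDensity G) (h0 : 0 ∈ K)
    (hg : Continuous g) (hM : 0 ≤ M)
    (hgM : ∀ v : Sph n, -(M * supportFn (K : Set (Rn n)) (v : Rn n)) ≤ g v) :
    ∃ B, 0 ≤ B ∧ ∀ t : ℝ, 0 < t → t * M ≤ 1 / 2 → ∀ u : Sph n,
      -B ≤ (G (radialFn (perturb K g hg t : Set (Rn n)) (u : Rn n)) u -
        G (radialFn (K : Set (Rn n)) (u : Rn n)) u) / t := by
  obtain ⟨R, hR0, hR⟩ := exists_subset_closedBall K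
  obtain ⟨B, hB0, hB⟩ := exists_bound_of_continuousOn hG.continuousOn_mul_deriv R
  refine ⟨2 * M * B, by positivity, fun t ht htM u => ?_⟩
  rw [le_div_iff₀ ht]
  set ρ := radialFn (K : Set (Rn n)) (u : Rn n) with hρ
  have hρ0 : 0 ≤ ρ := radialFn_nonneg K _
  have hle := mul_radialFn_le_radialFn_perturb h0 (hg := hg) hgM ht.le (by linarith) u
  have hmono := (hG.strictMonoOn u).monotoneOn
    (mul_nonneg (by linarith : 0 ≤ 1 - t * M) hρ0) (radialFn_nonneg _ _) hle
  suffices h : G ρ u - G ((1 - t * M) * ρ) u ≤ 2 * M * B * t by linarith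
  rcases (mul_nonneg (mul_nonneg ht.le hM) hρ0).eq_or_lt with h | h
  · have : (1 - t * M) * ρ = ρ := by linarith
    rw [this, sub_self]
    positivity
  · have hlt : (1 - t * M) * ρ < ρ := by linarith
    have hρp : 0 < ρ := lt_of_le_of_ne hρ0 fun h' => by rw [← h'] at h; simp at h
    have hp : 0 < (1 - t * M) * ρ := mul_pos (by linarith) hρp
    obtain ⟨ξ, ⟨hξ1, hξ2⟩, hξ⟩ := exists_deriv_eq_slope (fun s => G s u) hlt
      ((hG.continuousOn_left u).mono fun s hs => hp.le.trans hs.1)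
      fun s hs => (hG.differentiableAt s (hp.trans hs.1) u).differentiableWithinAt
    have hξ0 : 0 < ξ := hp.trans hξ1
    rw [eq_div_iff (by linarith)] at hξ
    rw [← hξ]
    have hb := (le_abs_self _).trans (hB ξ hξ0.le
      (hξ2.le.trans (radialFn_le_of_subset_closedBall hR0 hR u)) u)
    have hd := hG.deriv_pos ξ hξ0 u
    have h2ξ : ρ ≤ 2 * ξ := by nlinarith
    simp only at hb
    calc deriv (fun s => G s u) ξ * (ρ - (1 - t * M) * ρ)
        = (t * M) * (deriv (fun s => G s u) ξ * ρ) := by ring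
      _ ≤ (t * M) * (deriv (fun s => G s u) ξ * (2 * ξ)) := by gcongr
      _ = (2 * M * t) * (ξ * deriv (fun s => G s u) ξ) := by ring
      _ ≤ (2 * M * t) * B := by gcongr
      _ = 2 * M * B * t := by ring

theorem hasDerivAt_orliczEnergy {φ : ℝ → ℝ} (hφ : Continuous φ) (μ : Measure (Sph n))
    [IsFiniteMeasure μ] {h g : Sph n → ℝ} (hh : Continuous h) (hg : Continuous g) :
    HasDerivAt (fun t : ℝ => ∫ v, primitive φ (h v + t * g v) ∂μ) (∫ v, φ (h v) * g v ∂μ) 0 := by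
  have hΦ := continuous_primitive hφ
  have hcF : Continuous fun p : ℝ × Sph n => φ (h p.2 + p.1 * g p.2) * g p.2 := by fun_prop
  obtain ⟨B, hB⟩ := ((isCompact_closedBall (0 : ℝ) 1).prod
    (isCompact_univ (X := Sph n))).exists_bound_of_continuousOn hcF.continuousOn
  have := hasDerivAt_integral_of_dominated_loc_of_deriv_le (μ := μ) (x₀ := (0 : ℝ))
    (F := fun t v => primitive φ (h v + t * g v)) (F' := fun t v => φ (h v + t * g v) * g v)
    (bound := fun _ => B) (Metric.closedBall_mem_nhds (0 : ℝ) one_pos)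
    (Eventually.of_forall fun t => (by fun_prop : Continuous fun v =>
      primitive φ (h v + t * g v)).aestronglyMeasurable)
    (integrable_of_continuous_sphere (by fun_prop))
    (by fun_prop : Continuous fun v => φ (h v + 0 * g v) * g v).aestronglyMeasurable
    (Eventually.of_forall fun v t ht => hB (t, v) ⟨ht, trivial⟩)
    (integrable_const _) (Eventually.of_forall fun v t _ => ?_)
  · simpa using this.2
  · have h1 : HasDerivAt (fun t : ℝ => h v + t * g v) (g v) t := by
      simpa using ((hasDerivAt_id t).mul_const (g v)).const_add (h v)
    exact (hasDerivAt_primitive hφ _).comp t h1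

/-- The variational inequality for a minimiser. If the perturbation `h_K + t g` increases the dual
volume to first order, then it does not decrease the Orlicz energy to first order. The first-order
increase is bounded below by the integral over the regular directions plus the contribution
`η ε` of the directions that `K` misses and that the perturbed body reaches at distance `δ`. -/
theorem integral_nonneg_of_minimizer (hG : IsRadialDensity G) {φ : ℝ → ℝ} (hφ : Continuous φ)
    (hφ0 : ∀ s, 0 ≤ φ s) {μ : Measure (Sph n)} [IsFiniteMeasure μ] (h0 : 0 ∈ K)
    (hint : (interior (K : Set (Rn n))).Nonempty)
    (hmin : ∀ L : ConvexBody (Rn n), 0 ∈ L → dualVolume G K ≤ dualVolume G L →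
      orliczEnergy φ μ K ≤ orliczEnergy φ μ L)
    (hg : Continuous g) (hM : 0 ≤ M)
    (hgM : ∀ v : Sph n, -(M * supportFn (K : Set (Rn n)) (v : Rn n)) ≤ g v)
    (hℓ : Integrable (fun u => radialDensity G K u *
      (g (radialGauss K u) / supportFn (K : Set (Rn n)) (radialGauss K u : Rn n)))
      (sphereMeasure n))
    {δ η ε : ℝ} (hδ : 0 ≤ δ) (hη0 : 0 ≤ η) (hη : ∀ u, η ≤ G δ u - G 0 u)
    (hW : ∀ᶠ t in 𝓝[>] (0 : ℝ), ε * t ≤ (sphereMeasure n).real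
      {u : Sph n | radialFn (K : Set (Rn n)) (u : Rn n) = 0 ∧
        δ ≤ radialFn (perturb K g hg t : Set (Rn n)) (u : Rn n)})
    (hpos : 0 < ∫ u, radialDensity G K u *
      (g (radialGauss K u) / supportFn (K : Set (Rn n)) (radialGauss K u : Rn n))
      ∂(sphereMeasure n) + η * ε) :
    0 ≤ ∫ v : Sph n, φ (supportFn (K : Set (Rn n)) (v : Rn n)) * g v ∂μ := by
  by_contra! hneg
  obtain ⟨B, hB0, hB⟩ := hG.exists_le_slope h0 hg hM hgM
  set τ : ℝ := 1 / (2 * (M + 1)) with hτ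
  have hτ0 : 0 < τ := by positivity
  set t : ℕ → ℝ := fun i => τ / ((i : ℝ) + 1) with ht
  have ht0 : ∀ i, 0 < t i := fun i => by positivity
  have htM : ∀ i, t i * M ≤ 1 / 2 := fun i => by
    have h1 : t i ≤ τ := div_le_self hτ0.le (by linarith [(Nat.cast_nonneg i : (0 : ℝ) ≤ i)])
    have h2 : τ * M ≤ 1 / 2 := by
      rw [hτ, div_mul_eq_mul_div, div_le_div_iff₀ (by positivity) two_pos]
      linarith
    nlinarith
  have htlim : Tendsto t atTop (𝓝[>] 0) := by
    refine tendsto_nhdsWithin_iff.2 ⟨?_, Eventually.of_forall ht0⟩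
    have := tendsto_one_div_add_atTop_nhds_zero_nat.const_mul τ
    simpa [ht, div_eq_mul_inv] using this
  set q : ℕ → Sph n → ℝ := fun i u =>
    (G (radialFn (perturb K g hg (t i) : Set (Rn n)) (u : Rn n)) u -
      G (radialFn (K : Set (Rn n)) (u : Rn n)) u) / t i with hq
  have hqint : ∀ i, Integrable (q i) (sphereMeasure n) := fun i =>
    ((hG.integrable_radialFn zero_mem_perturb).sub (hG.integrable_radialFn h0)).div_const _
  set S : Set (Sph n) := {u | 0 < radialFn (K : Set (Rn n)) (u : Rn n)} with hS
  have hSm : MeasurableSet S := measurableSet_lt measurable_const (measurable_radialFn h0)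
  have hlow := eventually_lt_integral_of_liminf (m := sphereMeasure n) (M := B)
    (F := fun i => S.indicator (q i)) (a := -(η * ε)) hℓ (fun i => (hqint i).indicator hSm)
    (fun i u => by
      by_cases hu : u ∈ S
      · rw [indicator_of_mem hu]
        exact hB _ (ht0 i) (htM i) u
      · rw [indicator_of_notMem hu]
        linarith)
    (by
      filter_upwards [ae_isRegularDirection_or h0 hint] with u hu c hc
      rcases hu with hu | hu
      · have hmem : u ∈ S := hu.radialFn_pos
        simp only [indicator_of_mem hmem]
        exact htlim.eventually (hu.eventually_lt_slope hG h0 hg hc)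
      · have hmem : u ∉ S := fun h => (ne_of_gt h) hu
        simp only [indicator_of_notMem hmem]
        rw [radialDensity_eq_zero hu, zero_mul] at hc
        exact Eventually.of_forall fun _ => hc)
    (by linarith)
  have hJ := hasDerivAt_iff_tendsto_slope.1
    (hasDerivAt_orliczEnergy hφ μ (continuous_supportFn_sphere K) hg)
  have hJ' := (hJ.mono_left (nhdsWithin_mono 0 fun s (hs : s ∈ Ioi (0 : ℝ)) =>
    (ne_of_gt hs : s ≠ 0))).comp htlim |>.eventually_lt_const hneg
  obtain ⟨i, hi1, hi2, hi3⟩ := (hlow.and ((htlim.eventually hW).and hJ')).exists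
  -- the perturbed body has larger dual volume
  have hV : dualVolume G K ≤ dualVolume G (perturb K g hg (t i)) := by
    set W : Set (Sph n) := {u : Sph n | radialFn (K : Set (Rn n)) (u : Rn n) = 0 ∧
        δ ≤ radialFn (perturb K g hg (t i) : Set (Rn n)) (u : Rn n)} with hWdef
    have hWm : MeasurableSet W :=
      (measurableSet_eq_fun (measurable_radialFn h0) measurable_const).inter
        (measurableSet_le measurable_const (measurable_radialFn zero_mem_perturb))
    have h1 : ∫ u, (S.indicator (q i) u + W.indicator (fun _ => η / t i) u) ∂(sphereMeasure n) ≤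
        ∫ u, q i u ∂(sphereMeasure n) := by
      refine integral_mono (((hqint i).indicator hSm).add ((integrable_const _).indicator hWm))
        (hqint i) fun u => ?_
      by_cases hu : u ∈ S
      · have huW : u ∉ W := fun h => (ne_of_gt hu) h.1
        simp only [indicator_of_mem hu, indicator_of_notMem huW, add_zero, le_refl]
      · have hu0 : radialFn (K : Set (Rn n)) (u : Rn n) = 0 :=
          le_antisymm (not_lt.1 hu) (radialFn_nonneg K _)
        simp only [indicator_of_notMem hu, zero_add, hq, hu0]
        have hmon := (hG.strictMonoOn u).monotoneOn
        by_cases huW : u ∈ W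
        · simp only [indicator_of_mem huW]
          refine div_le_div_of_nonneg_right ((hη u).trans (sub_le_sub_right ?_ _)) (ht0 i).le
          exact hmon hδ (radialFn_nonneg _ _) huW.2
        · simp only [indicator_of_notMem huW]
          exact div_nonneg (sub_nonneg.2 (hmon self_mem_Ici (radialFn_nonneg _ _)
            (radialFn_nonneg _ _))) (ht0 i).le
    rw [integral_add ((hqint i).indicator hSm) ((integrable_const _).indicator hWm),
      integral_indicator_const _ hWm, smul_eq_mul] at h1
    have h2 : η * ε ≤ (sphereMeasure n).real W * (η / t i) := by
      rw [mul_div_assoc', le_div_iff₀ (ht0 i)]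
      nlinarith [mul_le_mul_of_nonneg_left hi2 hη0]
    have h3 : 0 < ∫ u, q i u ∂(sphereMeasure n) := by linarith
    rw [hq, integral_div, integral_sub (hG.integrable_radialFn zero_mem_perturb)
      (hG.integrable_radialFn h0)] at h3
    have h4 := (div_pos_iff_of_pos_right (ht0 i)).1 h3
    exact (sub_pos.1 h4).le
  -- but smaller energy
  have hle := hmin _ zero_mem_perturb hV
  have hE : orliczEnergy φ μ (perturb K g hg (t i)) ≤
      ∫ v : Sph n, primitive φ (supportFn (K : Set (Rn n)) (v : Rn n) + t i * g v) ∂μ := by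
    have hΦ := continuous_primitive hφ
    have hc := continuous_supportFn_sphere K
    refine integral_mono (integrable_of_continuous_sphere
      (hΦ.comp (continuous_supportFn_sphere _))) (integrable_of_continuous_sphere (by fun_prop))
      fun v => monotone_primitive hφ hφ0 ?_
    refine (supportFn_wulffShape_le v).trans (max_le le_rfl ?_)
    exact (mul_nonneg (by linarith [htM i]) (supportFn_nonneg h0 _)).trans
      (sub_mul_supportFn_le hgM (ht0 i).le v)
  simp only [Function.comp, slope_def_field, sub_zero, zero_mul, add_zero] at hi3
  rw [div_lt_iff₀ (ht0 i), zero_mul] at hi3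
  have h6 : orliczEnergy φ μ K =
    ∫ v : Sph n, primitive φ (supportFn (K : Set (Rn n)) (v : Rn n)) ∂μ := rfl
  linarith

end Variation

/-! ### The curvature equation for a minimiser -/

section CurvatureEquation

variable {n : ℕ} {K : ConvexBody (Rn n)} {G : ℝ → Sph n → ℝ} {φ : ℝ → ℝ} {μ : Measure (Sph n)}

theorem exists_mem_interior_ne_zero [Nonempty (Sph n)]
    (hint : (interior (K : Set (Rn n))).Nonempty) :
    ∃ z ∈ interior (K : Set (Rn n)), z ≠ 0 := by
  obtain ⟨e⟩ := ‹Nonempty (Sph n)›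
  have he : (e : Rn n) ≠ 0 := norm_ne_zero_iff.1 (by simp)
  have : Nontrivial (Rn n) := ⟨⟨_, _, he⟩⟩
  by_contra! h
  obtain ⟨z, hz⟩ := hint
  have h1 : interior (K : Set (Rn n)) = {0} :=
    Subset.antisymm (fun x hx => h x hx) (by rintro _ rfl; exact h z hz ▸ hz)
  exact not_isOpen_singleton (0 : Rn n) (h1 ▸ isOpen_interior)

theorem integral_radialDensity_pos [Nonempty (Sph n)] (hG : IsRadialDensity G) (h0 : 0 ∈ K)
    (hint : (interior (K : Set (Rn n))).Nonempty) :
    0 < ∫ u, radialDensity G K u ∂(sphereMeasure n) := by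
  rw [integral_pos_iff_support_of_nonneg hG.radialDensity_nonneg (hG.integrable_radialDensity h0)]
  have hopen : IsOpen ((↑) ⁻¹' openCone (interior (K : Set (Rn n))) : Set (Sph n)) :=
    (isOpen_openCone isOpen_interior).preimage continuous_subtype_val
  refine (hopen.measure_pos _ ?_).trans_le (measure_mono fun u hu => ?_)
  · obtain ⟨z, hz, hz0⟩ := exists_mem_interior_ne_zero hint
    have hn := norm_pos_iff.2 hz0
    refine ⟨⟨(‖z‖)⁻¹ • z, by simp [norm_smul, hn.ne']⟩, ‖z‖, hn, ?_⟩
    simpa [smul_smul, hn.ne'] using hz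
  · exact (hG.radialDensity_pos ((mem_openCone_iff h0).1 (openCone_mono interior_subset hu))).ne'

theorem continuous_weight (hφ : Continuous φ) : Continuous fun v : Sph n =>
    φ (supportFn (K : Set (Rn n)) (v : Rn n)) * supportFn (K : Set (Rn n)) (v : Rn n) := by
  have := continuous_supportFn_sphere K
  fun_prop

/-- The total weight is positive: otherwise `h_K` vanishes `μ`-almost everywhere, and then `μ`
lives in the hemisphere opposite to any interior point of `K`. -/
theorem integral_weight_pos [Nonempty (Sph n)] [IsFiniteMeasure μ]
    (hμ : NotConcentratedOnClosedHemisphere μ)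
    (hφ : Continuous φ) (hφ0 : ∀ s, 0 ≤ φ s) (hφpos : ∀ s, 0 < s → 0 < φ s) (h0 : 0 ∈ K)
    (hint : (interior (K : Set (Rn n))).Nonempty) :
    0 < ∫ v : Sph n, φ (supportFn (K : Set (Rn n)) (v : Rn n)) *
      supportFn (K : Set (Rn n)) (v : Rn n) ∂μ := by
  have hnn : ∀ v : Sph n, 0 ≤ φ (supportFn (K : Set (Rn n)) (v : Rn n)) *
      supportFn (K : Set (Rn n)) (v : Rn n) := fun v =>
    mul_nonneg (hφ0 _) (supportFn_nonneg h0 _)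
  refine lt_of_le_of_ne (integral_nonneg hnn) fun heq => ?_
  have hae := (integral_eq_zero_iff_of_nonneg hnn
    (integrable_of_continuous_sphere (continuous_weight hφ))).1 heq.symm
  obtain ⟨z, hz, hz0⟩ := exists_mem_interior_ne_zero hint
  have hn := norm_pos_iff.2 hz0
  have hpos := hμ ⟨(‖z‖)⁻¹ • z, by simp [norm_smul, hn.ne']⟩
  refine hpos.ne' (integral_eq_zero_of_ae ?_)
  filter_upwards [hae] with v hv
  have hv0 : supportFn (K : Set (Rn n)) (v : Rn n) = 0 := by
    by_contra hne
    have hp := lt_of_le_of_ne (supportFn_nonneg h0 (v : Rn n)) (Ne.symm hne)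
    exact (mul_pos (hφpos _ hp) hp).ne' hv
  have h1 := (mem_interior_iff_forall_inner_lt K).1 hz v
  rw [hv0] at h1
  simp only [inner_smul_right, Pi.zero_apply]
  exact max_eq_right (mul_nonpos_of_nonneg_of_nonpos (inv_nonneg.2 hn.le) h1.le)


/-- A minimiser of the Orlicz energy among the bodies of at least the same dual volume. -/
structure IsMinimizer (G : ℝ → Sph n → ℝ) (φ : ℝ → ℝ) (μ : Measure (Sph n))
    (K : ConvexBody (Rn n)) : Prop where
  zero_mem : 0 ∈ K
  interior_nonempty : (interior (K : Set (Rn n))).Nonempty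
  le_of_le : ∀ L : ConvexBody (Rn n), 0 ∈ L → dualVolume G K ≤ dualVolume G L →
    orliczEnergy φ μ K ≤ orliczEnergy φ μ L

/-- The variational inequality for the multiplicative perturbations `h_K (1 + t f)`. -/
theorem IsMinimizer.weighted_integral_nonneg [IsFiniteMeasure μ] (hK : IsMinimizer G φ μ K)
    (hG : IsRadialDensity G) (hφ : Continuous φ) (hφ0 : ∀ s, 0 ≤ φ s)
    {f : Sph n → ℝ} (hf : Continuous f)
    (hpos : 0 < ∫ u, radialDensity G K u * f (radialGauss K u) ∂(sphereMeasure n)) :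
    0 ≤ ∫ v : Sph n, φ (supportFn (K : Set (Rn n)) (v : Rn n)) *
      supportFn (K : Set (Rn n)) (v : Rn n) * f v ∂μ := by
  have h0 := hK.zero_mem
  obtain ⟨M, hM⟩ := isCompact_univ.exists_bound_of_continuousOn hf.continuousOn
  have hae : (fun u => radialDensity G K u *
      ((supportFn (K : Set (Rn n)) (radialGauss K u : Rn n) * f (radialGauss K u)) /
        supportFn (K : Set (Rn n)) (radialGauss K u : Rn n))) =ᵐ[sphereMeasure n]
      fun u => radialDensity G K u * f (radialGauss K u) := by
    filter_upwards [ae_isRegularDirection_or h0 hK.interior_nonempty] with u hu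
    rcases hu with hu | hu
    · rw [mul_div_cancel_left₀ _ hu.supportFn_pos.ne']
    · rw [radialDensity_eq_zero hu, zero_mul, zero_mul]
  have hint' : Integrable (fun u => radialDensity G K u * f (radialGauss K u))
      (sphereMeasure n) :=
    (hG.integrable_radialDensity h0).mul_bdd
      (hf.measurable.comp (measurable_radialGauss K)).aestronglyMeasurable
      (Eventually.of_forall fun u => hM _ trivial)
  have := integral_nonneg_of_minimizer (M := max M 0) (δ := 0) (η := 0) (ε := 0)
    (g := fun v => supportFn (K : Set (Rn n)) (v : Rn n) * f v) hG hφ hφ0 h0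
    hK.interior_nonempty hK.le_of_le ((continuous_supportFn_sphere K).mul hf) (le_max_right _ _)
    (fun v => ?_) (hint'.congr hae.symm) le_rfl le_rfl (fun u => by simp)
    (Eventually.of_forall fun t => by rw [zero_mul]; exact measureReal_nonneg)
    (by rw [integral_congr_ae hae]; simpa using hpos)
  · simpa only [mul_assoc] using this
  · have h1 := (neg_le_of_abs_le ((hM v trivial).trans (le_max_left M 0)))
    have h2 := supportFn_nonneg h0 (v : Rn n)
    nlinarith

/-- The Euler–Lagrange equation of the minimiser, tested against continuous functions. -/
theorem IsMinimizer.exists_multiplier [Nonempty (Sph n)] [IsFiniteMeasure μ]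
    (hK : IsMinimizer G φ μ K) (hμ : NotConcentratedOnClosedHemisphere μ)
    (hG : IsRadialDensity G) (hφ : Continuous φ)
    (hφ0 : ∀ s, 0 ≤ φ s) (hφpos : ∀ s, 0 < s → 0 < φ s) :
    ∃ τ : ℝ, 0 < τ ∧ ∀ f : Sph n → ℝ, Continuous f →
      ∫ v : Sph n, φ (supportFn (K : Set (Rn n)) (v : Rn n)) *
        supportFn (K : Set (Rn n)) (v : Rn n) * f v ∂μ =
      τ * ∫ u, radialDensity G K u * f (radialGauss K u) ∂(sphereMeasure n) := by
  have h0 := hK.zero_mem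
  have hD := integral_radialDensity_pos hG h0 hK.interior_nonempty
  have hT := integral_weight_pos hμ hφ hφ0 hφpos h0 hK.interior_nonempty
  set T₁ := ∫ u, radialDensity G K u ∂(sphereMeasure n) with hT₁
  set T₂ := ∫ v : Sph n, φ (supportFn (K : Set (Rn n)) (v : Rn n)) *
      supportFn (K : Set (Rn n)) (v : Rn n) ∂μ with hT₂
  have hlow : ∀ f : Sph n → ℝ, Continuous f →
      T₂ / T₁ * ∫ u, radialDensity G K u * f (radialGauss K u) ∂(sphereMeasure n) ≤
      ∫ v : Sph n, φ (supportFn (K : Set (Rn n)) (v : Rn n)) *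
        supportFn (K : Set (Rn n)) (v : Rn n) * f v ∂μ := by
    intro f hf
    obtain ⟨M, hM⟩ := isCompact_univ.exists_bound_of_continuousOn hf.continuousOn
    have hint' : Integrable (fun u => radialDensity G K u * f (radialGauss K u))
        (sphereMeasure n) :=
      (hG.integrable_radialDensity h0).mul_bdd
        (hf.measurable.comp (measurable_radialGauss K)).aestronglyMeasurable
        (Eventually.of_forall fun u => hM _ trivial)
    set I := ∫ u, radialDensity G K u * f (radialGauss K u) ∂(sphereMeasure n) with hI
    have hcc : ∀ c < I / T₁, c * T₂ ≤ ∫ v : Sph n,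
        φ (supportFn (K : Set (Rn n)) (v : Rn n)) *
          supportFn (K : Set (Rn n)) (v : Rn n) * f v ∂μ := by
      intro c hc
      rw [lt_div_iff₀ hD] at hc
      have h1 := hK.weighted_integral_nonneg hG hφ hφ0 (f := fun v => f v - c)
        (hf.sub continuous_const) (by
          simp only [mul_sub]
          rw [integral_sub hint' ((hG.integrable_radialDensity h0).mul_const c), integral_mul_const]
          linarith)
      simp only [mul_sub] at h1
      have h2 : Integrable (fun v : Sph n => φ (supportFn (K : Set (Rn n)) (v : Rn n)) *
          supportFn (K : Set (Rn n)) (v : Rn n) * f v) μ :=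
        integrable_of_continuous_sphere ((continuous_weight hφ).mul hf)
      rw [integral_sub h2
        ((integrable_of_continuous_sphere (continuous_weight hφ)).mul_const c),
        integral_mul_const] at h1
      linarith
    have h2 : T₂ / T₁ * I = I / T₁ * T₂ := by ring
    rw [h2]
    refine le_of_forall_lt fun b hb => ?_
    rw [← div_lt_iff₀ hT] at hb
    obtain ⟨c, hbc, hc⟩ := exists_between hb
    rw [div_lt_iff₀ hT] at hbc
    exact hbc.trans_le (hcc c hc)
  refine ⟨T₂ / T₁, div_pos hT hD, fun f hf => le_antisymm ?_ (hlow f hf)⟩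
  have h := hlow (fun v => -f v) hf.neg
  simp only [mul_neg, integral_neg] at h
  linarith

/-- The Euler–Lagrange equation as an identity of measures, tested against measurable functions. -/
theorem integral_weight_mul_eq [IsFiniteMeasure μ] (hG : IsRadialDensity G) (hφ : Continuous φ)
    (hφ0 : ∀ s, 0 ≤ φ s) (h0 : 0 ∈ K) {τ : ℝ} (hτ : 0 < τ)
    (heq : ∀ f : Sph n → ℝ, Continuous f →
      ∫ v : Sph n, φ (supportFn (K : Set (Rn n)) (v : Rn n)) *
        supportFn (K : Set (Rn n)) (v : Rn n) * f v ∂μ =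
      τ * ∫ u, radialDensity G K u * f (radialGauss K u) ∂(sphereMeasure n))
    {k : Sph n → ℝ} (hk : Measurable k)
    (hki : Integrable (fun v : Sph n => φ (supportFn (K : Set (Rn n)) (v : Rn n)) *
        supportFn (K : Set (Rn n)) (v : Rn n) * k v) μ) :
    Integrable (fun u => radialDensity G K u * k (radialGauss K u)) (sphereMeasure n) ∧
      ∫ v : Sph n, φ (supportFn (K : Set (Rn n)) (v : Rn n)) *
        supportFn (K : Set (Rn n)) (v : Rn n) * k v ∂μ =
      τ * ∫ u, radialDensity G K u * k (radialGauss K u) ∂(sphereMeasure n) := by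
  set w : Sph n → ℝ := fun v => φ (supportFn (K : Set (Rn n)) (v : Rn n)) *
    supportFn (K : Set (Rn n)) (v : Rn n) with hw
  have hwc : Continuous w := continuous_weight hφ
  have hw0 : ∀ v, 0 ≤ w v := fun v => mul_nonneg (hφ0 _) (supportFn_nonneg h0 _)
  set D : Sph n → ℝ := fun u => τ * radialDensity G K u with hDdef
  have hD0 : ∀ u, 0 ≤ D u := fun u => mul_nonneg hτ.le (hG.radialDensity_nonneg u)
  have hDm : Measurable D := (hG.measurable_radialDensity h0).const_mul τ
  have hDi : Integrable D (sphereMeasure n) := (hG.integrable_radialDensity h0).const_mul τ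
  have hα := measurable_radialGauss K
  let μ' : Measure (Sph n) := μ.withDensity fun v => ENNReal.ofReal (w v)
  let m : Measure (Sph n) := (sphereMeasure n).withDensity fun u => ENNReal.ofReal (D u)
  let ν : Measure (Sph n) := m.map (radialGauss K)
  have hfin1 : IsFiniteMeasure μ' :=
    isFiniteMeasure_withDensity_ofReal (integrable_of_continuous_sphere hwc).2
  have hfin2 : IsFiniteMeasure m := isFiniteMeasure_withDensity_ofReal hDi.2
  have hfin3 : IsFiniteMeasure ν := Measure.isFiniteMeasure_map m _
  have hμ' : ∀ f : Sph n → ℝ, ∫ v, f v ∂μ' = ∫ v, w v * f v ∂μ := fun f => by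
    rw [integral_withDensity_eq_integral_toReal_smul hwc.measurable.ennreal_ofReal
      (Eventually.of_forall fun _ => ENNReal.ofReal_lt_top)]
    simp only [ENNReal.toReal_ofReal (hw0 _), smul_eq_mul]
  have hm : ∀ f : Sph n → ℝ, ∫ u, f u ∂m = ∫ u, D u * f u ∂(sphereMeasure n) := fun f => by
    rw [integral_withDensity_eq_integral_toReal_smul hDm.ennreal_ofReal
      (Eventually.of_forall fun _ => ENNReal.ofReal_lt_top)]
    simp only [ENNReal.toReal_ofReal (hD0 _), smul_eq_mul]
  have hν : ∀ f : Sph n → ℝ, Measurable f → ∫ v, f v ∂ν =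
      τ * ∫ u, radialDensity G K u * f (radialGauss K u) ∂(sphereMeasure n) := fun f hf => by
    rw [integral_map hα.aemeasurable hf.aestronglyMeasurable, hm, ← integral_const_mul]
    simp only [hDdef, mul_assoc]
  have hμν : μ' = ν := ext_of_forall_integral_eq_of_IsFiniteMeasure fun f => by
    rw [hμ', hν _ f.continuous.measurable, heq _ f.continuous]
  have hki' : Integrable k μ' := by
    refine (integrable_withDensity_iff_integrable_smul' hwc.measurable.ennreal_ofReal
      (Eventually.of_forall fun _ => ENNReal.ofReal_lt_top)).2 ?_
    simpa only [ENNReal.toReal_ofReal (hw0 _), smul_eq_mul] using hki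
  refine ⟨?_, ?_⟩
  · rw [hμν] at hki'
    have h1 := (integrable_map_measure hk.aestronglyMeasurable hα.aemeasurable).1 hki'
    have h2 := (integrable_withDensity_iff_integrable_smul' hDm.ennreal_ofReal
      (Eventually.of_forall fun _ => ENNReal.ofReal_lt_top)).1 h1
    simp only [ENNReal.toReal_ofReal (hD0 _), smul_eq_mul, Function.comp_apply] at h2
    simp only [hDdef, mul_assoc] at h2
    simpa [inv_mul_cancel_left₀ hτ.ne'] using h2.const_mul τ⁻¹
  · rw [← hν k hk, ← hμν, hμ']

end CurvatureEquation

/-! ### The set `Ξ_K` of a minimiser -/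

section Packing

open scoped Pointwise

variable {n : ℕ} {K : ConvexBody (Rn n)}

theorem mem_Xi_iff (h0 : 0 ∈ K) {x : Rn n} :
    x ∈ Xi (K : Set (Rn n)) ↔ x ∈ K ∧ ∃ v : Sph n, inner ℝ (v : Rn n) x = 0 ∧
      supportFn (K : Set (Rn n)) (v : Rn n) = 0 := by
  simp only [Xi, reverseSphericalImage, mem_ofPred_eq, mem_frontier_iff, mem_unitNormals_iff K h0]
  constructor
  · rintro ⟨⟨hx, -⟩, v, hv, hvx⟩
    rw [mem_normalCone_iff K hx, hv] at hvx
    exact ⟨hx, v, hvx, hv⟩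
  · rintro ⟨hx, v, hvx, hv⟩
    exact ⟨⟨hx, v, hvx.trans hv.symm⟩, v, hv, (mem_normalCone_iff K hx).2 (hvx.trans hv.symm)⟩

/-- A bounded set has a finite separated subset whose balls cover it. -/
theorem exists_finset_separated_cover {A : Set (Rn n)} (hA : Bornology.IsBounded A) {r : ℝ}
    (hr : 0 < r) : ∃ C : Finset (Rn n), (C : Set (Rn n)) ⊆ A ∧
      (C : Set (Rn n)).Pairwise (fun x y => r < dist x y) ∧
      A ⊆ ⋃ x ∈ C, Metric.closedBall x r := by
  obtain ⟨r', rfl⟩ : ∃ r' : NNReal, (r' : ℝ) = r := ⟨⟨r, hr.le⟩, rfl⟩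
  obtain ⟨T, hTf, hT⟩ := Metric.totallyBounded_iff.1
    (hA.isCompact_closure.totallyBounded.subset subset_closure) (r' / 2) (half_pos hr)
  have hcov : Metric.IsCover (r' / 2) A T := fun x hx => by
    obtain ⟨y, hy, hxy⟩ := mem_iUnion₂.1 (hT hx)
    refine ⟨y, hy, ?_⟩
    change edist x y ≤ ((r' / 2 : NNReal) : ENNReal)
    rw [edist_le_coe, ← NNReal.coe_le_coe, coe_nndist]
    exact le_of_lt hxy
  have hfin : Metric.packingNumber r' A ≠ ⊤ := by
    have h1 := Metric.packingNumber_two_mul_le_externalCoveringNumber (r' / 2) A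
    rw [mul_div_cancel₀ _ two_ne_zero] at h1
    exact ((h1.trans hcov.externalCoveringNumber_le_encard).trans_lt
      (encard_lt_top_iff.2 hTf)).ne
  have hCfin : (Metric.maximalSeparatedSet r' A).Finite := by
    rw [← encard_ne_top_iff, Metric.encard_maximalSeparatedSet hfin]
    exact hfin
  refine ⟨hCfin.toFinset, by simpa using Metric.maximalSeparatedSet_subset, ?_, fun x hx => ?_⟩
  · rw [hCfin.coe_toFinset]
    intro x hx y hy hxy
    have h1 : (r' : ENNReal) < edist x y := Metric.isSeparated_maximalSeparatedSet hx hy hxy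
    rwa [edist_nndist, ENNReal.coe_lt_coe, ← NNReal.coe_lt_coe, coe_nndist] at h1
  · obtain ⟨y, hy, hxy⟩ := Metric.isCover_maximalSeparatedSet hfin hx
    change edist x y ≤ (r' : ENNReal) at hxy
    rw [edist_le_coe, ← NNReal.coe_le_coe, coe_nndist] at hxy
    exact mem_iUnion₂.2 ⟨y, by simpa using hy, hxy⟩

/-- Points slightly moved from `Ξ_K` against an interior direction leave the cone over `K`. -/
theorem notMem_openCone_of_mem_ball (h0 : 0 ∈ K) {z : Rn n} {a : ℝ} (ha : 0 < a)
    (hz : Metric.closedBall z a ⊆ (K : Set (Rn n))) {x : Rn n} (hx : x ∈ Xi (K : Set (Rn n)))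
    {s : ℝ} (hs : 0 < s) {y : Rn n} (hy : y ∈ Metric.ball (x - s • z) (s * a)) :
    y ∉ openCone (K : Set (Rn n)) := by
  rintro ⟨r, hr, hry⟩
  obtain ⟨hxK, v, hvx, hv⟩ := (mem_Xi_iff h0).1 hx
  have h1 := add_le_supportFn_of_closedBall_subset ha.le hz v
  rw [hv] at h1
  have h2 := inner_le_supportFn hry (v : Rn n)
  rw [hv, inner_smul_right] at h2
  have h3 : inner ℝ (v : Rn n) y ≤ 0 := by
    by_contra! h
    exact absurd h2 (not_le.2 (mul_pos hr h))
  have h4 : inner ℝ (v : Rn n) ((x - s • z) - y) < s * a := by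
    refine lt_of_le_of_lt (real_inner_le_norm _ _) ?_
    rw [show ‖(v : Rn n)‖ = 1 by simp, one_mul, ← dist_eq_norm, dist_comm]
    exact hy
  rw [inner_sub_right, inner_sub_right, inner_smul_right, hvx] at h4
  nlinarith

/-- The volume of a set of points at distance at most `R` is controlled by the spherical measure
of its set of directions. -/
theorem volume_le_of_directions {B : Set (Rn n)} {A : Set (Sph n)} (hn : n ≠ 0)
    (hA : MeasurableSet A) {R : ℝ} (hR : 0 < R)
    (h : ∀ y ∈ B, ∃ u ∈ A, ∃ r : ℝ, 0 < r ∧ r < R ∧ y = r • (u : Rn n)) :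
    (volume : Measure (Rn n)) B ≤ ENNReal.ofReal (R ^ n) * sphereMeasure n A := by
  have hsub : B ⊆ R • (Ioo (0 : ℝ) 1 • ((↑) '' A : Set (Rn n))) := by
    intro y hy
    obtain ⟨u, hu, r, hr, hrR, rfl⟩ := h y hy
    refine ⟨(r / R) • (u : Rn n), ⟨r / R, ⟨by positivity, (div_lt_one hR).2 hrR⟩, u, ⟨u, hu, rfl⟩,
      rfl⟩, ?_⟩
    simp only [smul_smul]
    rw [mul_div_cancel₀ _ hR.ne']
  refine (measure_mono hsub).trans ?_
  rw [Measure.addHaar_smul, finrank_euclideanSpace_fin, abs_of_nonneg (by positivity)]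
  gcongr
  rw [Measure.toSphere_apply' _ hA, finrank_euclideanSpace_fin]
  refine le_mul_of_one_le_left zero_le ?_
  exact_mod_cast Nat.one_le_iff_ne_zero.2 hn

/-- If `Ξ_K` has positive `(n-1)`-dimensional measure away from the origin, the directions missing
`K` and reaching points within distance `t` of `K`, far from the origin, have spherical measure at
least proportional to `t`. For the proof, place disjoint balls of radius comparable to `t`
outside the cone over `K`, near the points of a maximal separated subset of `Ξ_K`: their number
bounds the Hausdorff measure of `Ξ_K`, and their volume bounds the measure of directions. -/
theorem exists_le_measureReal_directions (hn : n ≠ 0) (h0 : 0 ∈ K)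
    (hint : (interior (K : Set (Rn n))).Nonempty) {δ : ℝ} (hδ : 0 < δ)
    (hH : Measure.hausdorffMeasure ((n - 1 : ℕ) : ℝ)
      (Xi (K : Set (Rn n)) \ Metric.ball 0 (2 * δ)) ≠ 0) :
    ∃ ε > 0, ∀ᶠ t in 𝓝[>] (0 : ℝ), ∀ A : Set (Sph n), MeasurableSet A →
      (∀ u : Sph n, (u : Rn n) ∉ openCone (K : Set (Rn n)) →
        (∃ r : ℝ, δ ≤ r ∧ ∃ x ∈ K, dist (r • (u : Rn n)) x ≤ t) → u ∈ A) →
      ε * t ≤ (sphereMeasure n).real A := by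
  obtain ⟨z, hz⟩ := hint
  obtain ⟨a, ha, haz⟩ := Metric.nhds_basis_closedBall.mem_iff.1 (mem_interior_iff_mem_nhds.1 hz)
  obtain ⟨R, hR0, hR⟩ := exists_subset_closedBall K
  set X := Xi (K : Set (Rn n)) \ Metric.ball 0 (2 * δ) with hX
  have hXK : X ⊆ K := fun x hx => ((mem_Xi_iff h0).1 hx.1).1
  have hXb : Bornology.IsBounded X := K.isBounded.subset hXK
  obtain ⟨c, hc⟩ : ∃ c : ℝ, c = a / (‖z‖ + a) := ⟨_, rfl⟩
  have hza : 0 < ‖z‖ + a := by positivity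
  have hc0 : 0 < c := by rw [hc]; positivity
  set ω : ℝ := (volume : Measure (Rn n)).real (Metric.ball 0 1) with hω
  have hω0 : 0 < ω := ENNReal.toReal_pos
    (Metric.measure_ball_pos volume _ one_pos).ne' measure_ball_lt_top.ne
  -- the counting estimate
  have hcount : ∀ t : ℝ, 0 < t → t ≤ δ → t ≤ 1 → ∀ A : Set (Sph n), MeasurableSet A →
      (∀ u : Sph n, (u : Rn n) ∉ openCone (K : Set (Rn n)) →
        (∃ r : ℝ, δ ≤ r ∧ ∃ x ∈ K, dist (r • (u : Rn n)) x ≤ t) → u ∈ A) →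
      ∃ C : Finset (Rn n), X ⊆ ⋃ x ∈ C, Metric.closedBall x (2 * (c * t)) ∧
        (C.card : ℝ) * ((c * t) ^ n * ω) ≤ (R + 2) ^ n * (sphereMeasure n).real A := by
    intro t ht htδ ht1 A hAm hA
    have hct : 0 < c * t := mul_pos hc0 ht
    obtain ⟨C, hCX, hCs, hCc⟩ := exists_finset_separated_cover hXb (r := 2 * (c * t))
      (by positivity)
    refine ⟨C, hCc, ?_⟩
    set s : ℝ := t / (‖z‖ + a) with hs
    have hs0 : 0 < s := by positivity
    have hsa : s * a = c * t := by rw [hs, hc]; ring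
    have hst : s * ‖z‖ + s * a = t := by rw [← mul_add, hs, div_mul_cancel₀ _ hza.ne']
    set B : Set (Rn n) := ⋃ x ∈ C, Metric.ball (x - s • z) (s * a) with hB
    have hvolB : (volume : Measure (Rn n)) B =
        (C.card : ENNReal) * (ENNReal.ofReal ((c * t) ^ n) * ENNReal.ofReal ω) := by
      rw [hB, measure_biUnion_finset]
      · simp only [hsa]
        rw [Finset.sum_congr rfl fun x _ => Measure.addHaar_ball_of_pos volume _ hct,
          Finset.sum_const, nsmul_eq_mul, finrank_euclideanSpace_fin, hω,
          ofReal_measureReal measure_ball_lt_top.ne]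
      · intro x hx y hy hxy
        refine Metric.ball_disjoint_ball ?_
        rw [dist_sub_right, hsa, ← two_mul]
        exact (hCs hx hy hxy).le
      · exact fun x _ => Metric.isOpen_ball.measurableSet
    have hle := volume_le_of_directions (B := B) hn hAm (R := R + 2) (by linarith) fun y hy => by
      obtain ⟨x, hxC, hyx⟩ := mem_iUnion₂.1 hy
      have hxX := hCX hxC
      have hxK := hXK hxX
      have hdist : dist y x ≤ t := by
        have h1 : dist y (x - s • z) < s * a := hyx
        have h2 : dist (x - s • z) x = s * ‖z‖ := by
          rw [dist_eq_norm, sub_sub_cancel_left, norm_neg, norm_smul, Real.norm_of_nonneg hs0.le]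
        linarith [dist_triangle y (x - s • z) x]
      have hxn : 2 * δ ≤ ‖x‖ := by simpa using hxX.2
      have hxR : ‖x‖ ≤ R := by simpa using hR hxK
      have h3 : ‖x‖ - ‖y‖ ≤ t := (norm_sub_norm_le x y).trans (by rwa [← dist_eq_norm, dist_comm])
      have h4 : ‖y‖ - ‖x‖ ≤ t := (norm_sub_norm_le y x).trans (by rwa [← dist_eq_norm])
      have hy0 : 0 < ‖y‖ := by linarith
      have hyu : y = ‖y‖ • ((‖y‖)⁻¹ • y) := by rw [smul_smul, mul_inv_cancel₀ hy0.ne', one_smul]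
      refine ⟨⟨(‖y‖)⁻¹ • y, by simp [norm_smul, hy0.ne']⟩, hA _ ?_ ?_, ‖y‖, hy0, by linarith, hyu⟩
      · rw [smul_mem_openCone (inv_pos.2 hy0)]
        exact notMem_openCone_of_mem_ball h0 ha haz hxX.1 hs0 hyx
      · exact ⟨‖y‖, by linarith, x, hxK, by rw [← hyu]; exact hdist⟩
    rw [hvolB] at hle
    have h5 := ENNReal.toReal_mono (ENNReal.mul_ne_top ENNReal.ofReal_ne_top
      (measure_ne_top _ _)) hle
    rwa [ENNReal.toReal_mul, ENNReal.toReal_mul, ENNReal.toReal_mul, ENNReal.toReal_natCast,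
      ENNReal.toReal_ofReal (by positivity), ENNReal.toReal_ofReal hω0.le,
      ENNReal.toReal_ofReal (by positivity)] at h5
  by_contra! hcon
  -- choose scales along which the number of balls is too small
  have hbad : ∀ k : ℕ, ∃ t : ℝ, 0 < t ∧ t ≤ 1 / ((k : ℝ) + 1) ∧
      ∃ C : Finset (Rn n), X ⊆ ⋃ x ∈ C, Metric.closedBall x (2 * (c * t)) ∧
        (C.card : ℝ) * ((c * t) ^ n * ω) ≤ (R + 2) ^ n * (1 / ((k : ℝ) + 1) * t) := by
    intro k
    have hk : (0 : ℝ) < 1 / ((k : ℝ) + 1) := by positivity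
    have hev : ∀ᶠ t in 𝓝[>] (0 : ℝ), t ≤ δ ∧ t ≤ 1 ∧ t ≤ 1 / ((k : ℝ) + 1) ∧ 0 < t := by
      filter_upwards [Ioo_mem_nhdsGT hδ, Ioo_mem_nhdsGT one_pos, Ioo_mem_nhdsGT hk]
        with t h1 h2 h3
      exact ⟨h1.2.le, h2.2.le, h3.2.le, h1.1⟩
    obtain ⟨t, ⟨A, hAm, hA, hlt⟩, htδ, ht1, htk, ht0⟩ := ((hcon _ hk).and_eventually hev).exists
    obtain ⟨C, hC1, hC2⟩ := hcount t ht0 htδ ht1 A hAm hA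
    exact ⟨t, ht0, htk, C, hC1, hC2.trans (by gcongr)⟩
  choose t ht0 htk C hCX hCn using hbad
  refine hH (le_antisymm ?_ zero_le)
  have ht_lim : Tendsto t atTop (𝓝 0) := squeeze_zero (fun k => (ht0 k).le) htk
    tendsto_one_div_add_atTop_nhds_zero_nat
  have hdiam : ∀ k (x : C k), Metric.ediam (Metric.closedBall (x : Rn n) (2 * (c * t k))) ≤
      ENNReal.ofReal (4 * (c * t k)) := fun k x => by
    rw [← Metric.closedEBall_ofReal (by have := ht0 k; positivity)]
    refine Metric.ediam_closedEBall_le.trans_eq ?_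
    rw [show (4 : ℝ) * (c * t k) = 2 * (2 * (c * t k)) by ring, ENNReal.ofReal_mul zero_le_two]
    simp
  have hle := Measure.hausdorffMeasure_le_liminf_sum ((n - 1 : ℕ) : ℝ) X (l := atTop)
    (ι := fun k => C k) (fun k => ENNReal.ofReal (4 * (c * t k)))
    (by
      rw [← ENNReal.ofReal_zero]
      refine ENNReal.tendsto_ofReal ?_
      simpa using (ht_lim.const_mul c).const_mul 4)
    (fun k x => Metric.closedBall (x : Rn n) (2 * (c * t k)))
    (Eventually.of_forall fun k x => hdiam k x)
    (Eventually.of_forall fun k => by simpa [iUnion_subtype] using hCX k)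
  refine hle.trans ?_
  set Q : ℝ := 4 ^ (n - 1) * ((R + 2) ^ n / (c * ω)) with hQ
  have hQlim : Tendsto (fun k : ℕ => ENNReal.ofReal (Q * (1 / ((k : ℝ) + 1)))) atTop (𝓝 0) := by
    rw [← ENNReal.ofReal_zero]
    refine ENNReal.tendsto_ofReal ?_
    simpa using tendsto_one_div_add_atTop_nhds_zero_nat.const_mul Q
  rw [← hQlim.liminf_eq]
  refine liminf_le_liminf (Eventually.of_forall fun k => ?_)
  have htk0 := ht0 k
  calc ∑ x : C k, Metric.ediam (Metric.closedBall (x : Rn n) (2 * (c * t k))) ^ ((n - 1 : ℕ) : ℝ)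
      ≤ ∑ _x : C k, ENNReal.ofReal ((4 * (c * t k)) ^ (n - 1)) := by
        refine Finset.sum_le_sum fun x _ => ?_
        rw [ENNReal.rpow_natCast, ENNReal.ofReal_pow (by positivity)]
        exact pow_le_pow_left' (hdiam k x) _
    _ = ENNReal.ofReal ((C k).card * (4 * (c * t k)) ^ (n - 1)) := by
        rw [Finset.sum_const, nsmul_eq_mul, ENNReal.ofReal_mul (by positivity),
          ENNReal.ofReal_natCast]
        simp
    _ ≤ ENNReal.ofReal (Q * (1 / ((k : ℝ) + 1))) := by
        refine ENNReal.ofReal_le_ofReal ?_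
        have h1 := hCn k
        obtain ⟨m, rfl⟩ := Nat.exists_eq_succ_of_ne_zero hn
        have h2 : ((C k).card : ℝ) * (c * t k) ^ m ≤
            (R + 2) ^ (m + 1) / (c * ω) * (1 / ((k : ℝ) + 1)) := by
          rw [div_mul_eq_mul_div, le_div_iff₀ (by positivity)]
          refine le_of_mul_le_mul_right ?_ htk0
          calc ((C k).card : ℝ) * (c * t k) ^ m * (c * ω) * t k
              = ((C k).card : ℝ) * ((c * t k) ^ (m + 1) * ω) := by ring
            _ ≤ _ := h1
            _ = _ := by rw [Nat.succ_eq_add_one]; ring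
        simp only [Nat.succ_eq_add_one, Nat.add_sub_cancel] at hQ ⊢
        calc ((C k).card : ℝ) * (4 * (c * t k)) ^ m
            = 4 ^ m * (((C k).card : ℝ) * (c * t k) ^ m) := by rw [mul_pow]; ring
          _ ≤ 4 ^ m * ((R + 2) ^ (m + 1) / (c * ω) * (1 / ((k : ℝ) + 1))) := by gcongr
          _ = Q * (1 / ((k : ℝ) + 1)) := by rw [hQ]; ring

/-- The singular set `Ξ_K` of a minimiser is negligible. Otherwise parallel bodies, slightly shrunk,
gain dual volume of first order in the directions that `K` misses, and the Euler–Lagrange equation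
shows that this gain costs no Orlicz energy. -/
theorem IsMinimizer.hausdorffMeasure_Xi_eq_zero [Nonempty (Sph n)] {G : ℝ → Sph n → ℝ} {φ : ℝ → ℝ}
    {μ : Measure (Sph n)} [IsFiniteMeasure μ] (hK : IsMinimizer G φ μ K) (hn : 2 ≤ n)
    (hG : IsRadialDensity G) (hφ : Continuous φ)
    (hφ0 : ∀ s, 0 ≤ φ s) (hφz : φ 0 = 0) {τ : ℝ} (hτ : 0 < τ)
    (heq : ∀ f : Sph n → ℝ, Continuous f →
      ∫ v : Sph n, φ (supportFn (K : Set (Rn n)) (v : Rn n)) *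
        supportFn (K : Set (Rn n)) (v : Rn n) * f v ∂μ =
      τ * ∫ u, radialDensity G K u * f (radialGauss K u) ∂(sphereMeasure n)) :
    Measure.hausdorffMeasure ((n - 1 : ℕ) : ℝ) (Xi (K : Set (Rn n))) = 0 := by
  have h0 := hK.zero_mem
  have hint := hK.interior_nonempty
  suffices hmain : ∀ δ : ℝ, 0 < δ → Measure.hausdorffMeasure ((n - 1 : ℕ) : ℝ)
      (Xi (K : Set (Rn n)) \ Metric.ball 0 (2 * δ)) = 0 by
    have hsub : Xi (K : Set (Rn n)) ⊆ {0} ∪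
        ⋃ k : ℕ, Xi (K : Set (Rn n)) \ Metric.ball 0 (2 * (1 / ((k : ℝ) + 1))) := by
      intro x hx
      by_cases hx0 : x = 0
      · exact Or.inl hx0
      · right
        obtain ⟨k, hk⟩ := exists_nat_one_div_lt (half_pos (norm_pos_iff.2 hx0))
        refine mem_iUnion.2 ⟨k, hx, ?_⟩
        rw [mem_ball_zero_iff, not_lt]
        linarith
    refine measure_mono_null hsub (measure_union_null ?_ (measure_iUnion_null fun k =>
      hmain _ (by positivity)))
    have : NullSingletonClass (Measure.hausdorffMeasure ((n - 1 : ℕ) : ℝ) : Measure (Rn n)) :=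
      Measure.nullSingletonClass_hausdorff _ (by exact_mod_cast (by lia : 0 < n - 1))
    exact measure_singleton 0
  intro δ hδ
  by_contra hH
  obtain ⟨ε, hε, hεW⟩ := exists_le_measureReal_directions (by lia) h0 hint hδ hH
  -- a uniform gain of `G` from radius `0` to radius `δ / 2`
  obtain ⟨η, hη0, hη⟩ : ∃ η > 0, ∀ u, η ≤ G (δ / 2) u - G 0 u := by
    have hc : ∀ s : ℝ, 0 ≤ s → Continuous fun u => G s u := fun s hs =>
      hG.continuousOn.comp_continuous (f := fun u => (s, u)) (by fun_prop) fun u => ⟨hs, trivial⟩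
    obtain ⟨u₀, -, h⟩ := isCompact_univ.exists_isMinOn univ_nonempty
      ((hc (δ / 2) (by positivity)).sub (hc 0 le_rfl)).continuousOn
    exact ⟨_, sub_pos.2 (hG.strictMonoOn u₀ self_mem_Ici (half_pos hδ).le (half_pos hδ)),
      fun u => h (mem_univ u)⟩
  have hh := continuous_supportFn_sphere K
  set h : Sph n → ℝ := fun v => supportFn (K : Set (Rn n)) (v : Rn n) with hhdef
  have hwk : (fun v : Sph n => φ (h v) * h v * (h v)⁻¹) = fun v => φ (h v) := by
    ext v
    by_cases hv : h v = 0
    · rw [hv, hφz, zero_mul, zero_mul]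
    · rw [mul_inv_cancel_right₀ hv]
  have hφi : Integrable (fun v => φ (h v)) μ := integrable_of_continuous_sphere (by fun_prop)
  obtain ⟨hA1, hA2⟩ := integral_weight_mul_eq hG hφ hφ0 h0 hτ heq (k := fun v => (h v)⁻¹)
    hh.measurable.inv (by rw [hwk]; exact hφi)
  rw [hwk] at hA2
  have hT := heq (fun _ => 1) continuous_const
  simp only [mul_one] at hT
  have hDpos := integral_radialDensity_pos hG h0 hint
  set A₁ := ∫ u, radialDensity G K u * (h (radialGauss K u))⁻¹ ∂(sphereMeasure n) with hA₁
  set T₁ := ∫ u, radialDensity G K u ∂(sphereMeasure n) with hT₁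
  have hA0 : 0 ≤ A₁ := integral_nonneg fun u =>
    mul_nonneg (hG.radialDensity_nonneg u) (inv_nonneg.2 (supportFn_nonneg h0 _))
  have hηε : 0 < η * ε := mul_pos hη0 hε
  -- the shrinking rate that cancels the regular gain and half of the singular one
  set s : ℝ := (A₁ + η * ε / 2) / T₁ with hs
  have hs0 : 0 ≤ s := by positivity
  have hsT : s * T₁ = A₁ + η * ε / 2 := div_mul_cancel₀ _ hDpos.ne'
  have hg : Continuous fun v : Sph n => 1 - s * h v := by fun_prop
  have hae : (fun u => radialDensity G K u * ((1 - s * h (radialGauss K u)) /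
      h (radialGauss K u))) =ᵐ[sphereMeasure n]
      fun u => radialDensity G K u * (h (radialGauss K u))⁻¹ - radialDensity G K u * s := by
    filter_upwards [ae_isRegularDirection_or h0 hint] with u hu
    rcases hu with hu | hu
    · have := hu.supportFn_pos.ne'
      rw [← mul_sub, sub_div, one_div, mul_div_cancel_right₀ _ this]
    · rw [radialDensity_eq_zero hu, zero_mul, zero_mul, zero_mul, sub_zero]
  have hDi := (hG.integrable_radialDensity h0).mul_const s
  have hval : ∫ u, radialDensity G K u * ((1 - s * h (radialGauss K u)) /
      h (radialGauss K u)) ∂(sphereMeasure n) = -(η * ε / 2) := by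
    rw [integral_congr_ae hae, integral_sub hA1 hDi, integral_mul_const, ← hA₁, ← hT₁, mul_comm T₁,
      hsT]
    ring
  have hfin := integral_nonneg_of_minimizer (M := s) (δ := δ / 2) (η := η) (ε := ε) hG hφ hφ0 h0
    hint hK.le_of_le hg hs0 (fun v => by simp only [hhdef]; linarith)
    ((hA1.sub hDi).congr hae.symm) (half_pos hδ).le hη0.le hη ?_ (by rw [hval]; linarith)
  · have hsplit : ∫ v, φ (h v) * (1 - s * h v) ∂μ =
        ∫ v, φ (h v) ∂μ - s * ∫ v, φ (h v) * h v ∂μ := by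
      rw [← integral_const_mul, ← integral_sub hφi
        (integrable_of_continuous_sphere (by fun_prop))]
      exact integral_congr_ae (Eventually.of_forall fun v => by simp only; ring)
    rw [hsplit, hA2, hT] at hfin
    nlinarith [mul_pos hτ hηε]
  · have hst : ∀ᶠ t in 𝓝[>] (0 : ℝ), s * t ≤ 1 / 2 := by
      have hc : Continuous fun t : ℝ => s * t := by fun_prop
      have h1 : s * 0 < 1 / 2 := by norm_num
      exact ((hc.continuousAt.eventually_lt_const h1).filter_mono nhdsWithin_le_nhds).mono
        fun _ h => h.le
    filter_upwards [hεW, hst, self_mem_nhdsWithin] with t ht hst ht0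
    have ht0' : 0 < t := ht0
    refine ht _ ((measurableSet_eq_fun (measurable_radialFn h0) measurable_const).inter
      (measurableSet_le measurable_const (measurable_radialFn zero_mem_perturb))) ?_
    rintro u hu ⟨r, hr, x, hx, hd⟩
    have hr0 : 0 < r := hδ.trans_le hr
    refine ⟨le_antisymm (not_lt.1 fun h' => hu ((mem_openCone_iff h0).2 h'))
      (radialFn_nonneg K _), ?_⟩
    refine le_trans (by nlinarith : δ / 2 ≤ (1 - s * t) * r)
      (le_radialFn (mul_nonneg (by linarith) hr0.le) (mem_perturb_of_forall fun v => ?_))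
    have h1 : inner ℝ (v : Rn n) (r • (u : Rn n)) ≤ h v + t := by
      have h2 : inner ℝ (v : Rn n) (r • (u : Rn n) - x) ≤ t := by
        refine (real_inner_le_norm _ _).trans ?_
        rw [show ‖(v : Rn n)‖ = 1 by simp, one_mul, ← dist_eq_norm]
        exact hd
      rw [inner_sub_right] at h2
      linarith [inner_le_supportFn hx (v : Rn n)]
    rw [mul_smul, inner_smul_right]
    refine (mul_le_mul_of_nonneg_left h1 (by linarith)).trans ?_
    change (1 - s * t) * (h v + t) ≤ h v + t * (1 - s * h v)
    nlinarith [mul_nonneg hs0 (mul_nonneg ht0'.le ht0'.le)]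

end Packing

/-! ### Solutions force `μ` to charge every open hemisphere -/

section Necessity

variable {n : ℕ} {K : ConvexBody (Rn n)} {G : ℝ → Sph n → ℝ}

theorem euclideanHausdorffMeasure_eq_zero_iff {d : ℕ} {s : Set (Rn n)} :
    Measure.euclideanHausdorffMeasure d s = 0 ↔ Measure.hausdorffMeasure (d : ℝ) s = 0 := by
  rw [Measure.euclideanHausdorffMeasure_def, Measure.smul_apply, ENNReal.smul_def, smul_eq_mul,
    mul_eq_zero, ENNReal.coe_eq_zero,
    or_iff_right (Measure.addHaarScalarFactor_volume_hausdorffMeasure_ne_zero d)]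

/-- Leaving the interior of `K` in direction `v`, one exits at a boundary point all of whose
normals make an acute angle with `v`. -/
theorem exists_exit_point {y : Rn n} (hy : y ∈ interior (K : Set (Rn n))) (v : Sph n) :
    ∃ s : ℝ, y + s • (v : Rn n) ∈ frontier (K : Set (Rn n)) ∧ ∀ u : Sph n,
      inner ℝ (u : Rn n) (y + s • (v : Rn n)) = supportFn (K : Set (Rn n)) (u : Rn n) →
        0 < inner ℝ (u : Rn n) (v : Rn n) := by
  have hv : ‖(v : Rn n)‖ = 1 := by simp
  set T : Set ℝ := {s | 0 ≤ s ∧ y + s • (v : Rn n) ∈ (K : Set (Rn n))} with hT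
  have hTcl : IsClosed T := isClosed_Ici.inter
    (K.isClosed.preimage (f := fun s : ℝ => y + s • (v : Rn n)) (by fun_prop))
  have hTne : T.Nonempty := ⟨0, le_rfl, by simpa using interior_subset hy⟩
  have hTb : BddAbove T := by
    obtain ⟨R, hR⟩ := K.isBounded.exists_norm_le
    refine ⟨R + ‖y‖, fun s hs => ?_⟩
    have h1 := hR _ hs.2
    have h2 : ‖s • (v : Rn n)‖ ≤ ‖y + s • (v : Rn n)‖ + ‖y‖ := by
      have := norm_sub_le (y + s • (v : Rn n)) y
      rwa [add_sub_cancel_left] at this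
    rw [norm_smul, hv, mul_one, Real.norm_of_nonneg hs.1] at h2
    linarith
  have hmem := hTcl.csSup_mem hTne hTb
  set s := sSup T with hs
  refine ⟨s, ?_, fun u hu => ?_⟩
  · rw [K.isClosed.frontier_eq]
    refine ⟨hmem.2, fun hi => ?_⟩
    have hc : ContinuousAt (fun r : ℝ => y + r • (v : Rn n)) s := by fun_prop
    have h2 : ∀ᶠ r in 𝓝 s, y + r • (v : Rn n) ∈ (K : Set (Rn n)) :=
      hc (mem_interior_iff_mem_nhds.1 hi)
    obtain ⟨r, hr, hr2⟩ := (h2.filter_mono nhdsWithin_le_nhds |>.and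
      (self_mem_nhdsWithin (s := Ioi s))).exists
    exact absurd (le_csSup hTb ⟨hmem.1.trans (le_of_lt hr2), hr⟩) (not_le.2 hr2)
  · have h1 := (mem_interior_iff_forall_inner_lt K).1 hy u
    rw [← hu, inner_add_right, inner_smul_right] at h1
    exact pos_of_mul_pos_right (by linarith) hmem.1

/-- If `Ξ_K` is negligible, some boundary point outside `Ξ_K` has only normals that make an acute
angle with a given direction: the exit points in that direction project onto a set with interior
points. -/
theorem exists_frontier_point_notMem_Xi (hint : (interior (K : Set (Rn n))).Nonempty)
    (hn : 2 ≤ n) (hXi : Measure.hausdorffMeasure ((n - 1 : ℕ) : ℝ) (Xi (K : Set (Rn n))) = 0)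
    (v : Sph n) :
    ∃ x ∈ frontier (K : Set (Rn n)), x ∉ Xi (K : Set (Rn n)) ∧ ∀ u : Sph n,
      inner ℝ (u : Rn n) x = supportFn (K : Set (Rn n)) (u : Rn n) →
        0 < inner ℝ (u : Rn n) (v : Rn n) := by
  by_contra! hcon
  obtain ⟨z, hz⟩ := hint
  obtain ⟨a, ha, haz⟩ := Metric.isOpen_iff.1 isOpen_interior z hz
  have hv0 : (v : Rn n) ≠ 0 := norm_ne_zero_iff.1 (by simp)
  let W : Submodule ℝ (Rn n) := (ℝ ∙ (v : Rn n))ᗮ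
  let π : Rn n →L[ℝ] W := W.orthogonalProjectionOnto
  have hπv : π (v : Rn n) = 0 := by
    refine Submodule.orthogonalProjectionOnto_orthogonal_apply_eq_zero
      (Submodule.mem_span_singleton_self _)
  have hsub : Metric.ball (π z) a ⊆ π '' Xi (K : Set (Rn n)) := by
    intro w hw
    have hy : z + ((w - π z : W) : Rn n) ∈ interior (K : Set (Rn n)) := by
      refine haz ?_
      rw [Metric.mem_ball, dist_eq_norm] at hw ⊢
      simpa using hw
    obtain ⟨s, hs, hs'⟩ := exists_exit_point hy v
    refine ⟨z + ((w - π z : W) : Rn n) + s • (v : Rn n), ?_, ?_⟩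
    · by_contra hX
      obtain ⟨u, hu, hu'⟩ := hcon _ hs hX
      exact absurd (hs' u hu) (not_lt.2 hu')
    · rw [map_add, map_add, map_smul, hπv, smul_zero, add_zero]
      have : π ((w - π z : W) : Rn n) = w - π z :=
        Submodule.orthogonalProjectionOnto_mem_subspace_eq_self _
      rw [this, add_sub_cancel]
  have hrank : Module.finrank ℝ W = n - 1 := by
    have : Fact (Module.finrank ℝ (Rn n) = (n - 1) + 1) :=
      ⟨by rw [finrank_euclideanSpace_fin]; lia⟩
    exact Submodule.finrank_orthogonal_span_singleton hv0
  have hnull : Measure.hausdorffMeasure ((n - 1 : ℕ) : ℝ) (π '' Xi (K : Set (Rn n))) = 0 := by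
    have hlip : LipschitzWith 1 π := by
      refine π.lipschitz.weaken ?_
      exact W.orthogonalProjectionOnto_norm_le
    have := hlip.hausdorffMeasure_image_le (d := ((n - 1 : ℕ) : ℝ)) (by positivity)
      (Xi (K : Set (Rn n)))
    rw [hXi, mul_zero] at this
    exact le_antisymm this zero_le
  have hpos : 0 < Measure.hausdorffMeasure ((n - 1 : ℕ) : ℝ) (Metric.ball (π z) a) := by
    rw [← hrank]
    exact Metric.measure_ball_pos _ _ ha
  exact hpos.ne' (measure_mono_null hsub hnull)

/-- The dual curvature measure charges every open hemisphere. -/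
theorem dualCurvature_pos (hG : IsRadialDensity G) (h0 : 0 ∈ K)
    (hint : (interior (K : Set (Rn n))).Nonempty)
    (hn : 2 ≤ n) (hXi : Measure.hausdorffMeasure ((n - 1 : ℕ) : ℝ) (Xi (K : Set (Rn n))) = 0)
    (v : Sph n) :
    0 < dualCurvature G (K : Set (Rn n)) {u : Sph n | 0 < inner ℝ (u : Rn n) (v : Rn n)} := by
  obtain ⟨x, hxf, hxX, hxv⟩ := exists_frontier_point_notMem_Xi hint hn hXi v
  obtain ⟨hxK, u₀, hu₀⟩ := (mem_frontier_iff K).1 hxf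
  have hnz : ∀ u : Sph n, inner ℝ (u : Rn n) x = 0 →
      supportFn (K : Set (Rn n)) (u : Rn n) ≠ 0 := fun u h h' =>
    hxX ((mem_Xi_iff h0).2 ⟨hxK, u, h, h'⟩)
  have hpos₀ : 0 < inner ℝ (u₀ : Rn n) x := by
    refine lt_of_le_of_ne (hu₀ ▸ supportFn_nonneg h0 _) fun h => ?_
    exact hnz u₀ h.symm (by rw [← hu₀, ← h])
  have hx0 : x ≠ 0 := fun h => by rw [h, inner_zero_right] at hpos₀; exact lt_irrefl _ hpos₀
  have hxn := norm_pos_iff.2 hx0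
  let w₀ : Sph n := ⟨(‖x‖)⁻¹ • x, by simp [norm_smul, hxn.ne']⟩
  -- the segment from the origin to `x` runs through the interior
  have hx_int : (1 / 2 : ℝ) • x ∈ interior (K : Set (Rn n)) := by
    rw [mem_interior_iff_forall_inner_lt]
    intro u
    rw [inner_smul_right]
    have h1 := inner_le_supportFn hxK (u : Rn n)
    have h2 := supportFn_nonneg h0 (u : Rn n)
    by_contra! h3
    exact hnz u (by linarith) (by linarith)
  have hw₀ : (w₀ : Rn n) ∈ openCone (interior (K : Set (Rn n))) := by
    change (‖x‖)⁻¹ • x ∈ openCone (interior (K : Set (Rn n)))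
    rw [smul_mem_openCone (inv_pos.2 hxn)]
    exact ⟨1 / 2, by norm_num, hx_int⟩
  have hopen : IsOpen (openCone (interior (K : Set (Rn n)))) := isOpen_openCone isOpen_interior
  have hgauge : gauge (K : Set (Rn n)) (w₀ : Rn n) = (‖x‖)⁻¹ := by
    rw [gauge_eq_inv_radialFn h0 (openCone_mono interior_subset hw₀)]
    congr 1
    refine le_antisymm ?_ (le_radialFn hxn.le ?_)
    · have h1 := inner_radialMap_le h0 w₀ u₀
      simp only [w₀, inner_smul_right] at h1
      rw [← hu₀, ← mul_assoc] at h1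
      have h2 := le_of_mul_le_mul_right (h1.trans_eq (one_mul _).symm) hpos₀
      rwa [mul_inv_le_iff₀ hxn, one_mul] at h2
    · simpa [w₀, smul_smul, hxn.ne'] using hxK
  have hgc : ContinuousAt (gauge (K : Set (Rn n))) (w₀ : Rn n) :=
    ((convexOn_gauge h0).continuousOn hopen).continuousAt (hopen.mem_nhds hw₀)
  -- near the direction of `x`, all normals still make an acute angle with `v`
  have hnear : ∀ᶠ w : Sph n in 𝓝 w₀, ∀ u ∈ (univ : Set (Sph n)),
      inner ℝ (u : Rn n) (v : Rn n) ≤ 0 → inner ℝ (u : Rn n) (w : Rn n) <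
        gauge (K : Set (Rn n)) (w : Rn n) * supportFn (K : Set (Rn n)) (u : Rn n) := by
    refine isCompact_univ.eventually_forall_of_forall_eventually fun u _ => ?_
    rcases lt_or_ge 0 (inner ℝ (u : Rn n) (v : Rn n) : ℝ) with hu | hu
    · have hc : Continuous fun p : Sph n × Sph n => (inner ℝ (p.2 : Rn n) (v : Rn n) : ℝ) := by
        fun_prop
      filter_upwards [hc.continuousAt.eventually_const_lt hu] with p hp hp'
      exact absurd hp (not_lt.2 hp')
    · have hlt : inner ℝ (u : Rn n) (w₀ : Rn n) <
          gauge (K : Set (Rn n)) (w₀ : Rn n) * supportFn (K : Set (Rn n)) (u : Rn n) := by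
        rw [hgauge]
        simp only [w₀, inner_smul_right]
        refine mul_lt_mul_of_pos_left (lt_of_le_of_ne (inner_le_supportFn hxK _) fun h => ?_)
          (inv_pos.2 hxn)
        exact absurd (hxv u h) (not_lt.2 hu)
      have hl : Continuous fun p : Sph n × Sph n => (inner ℝ (p.2 : Rn n) (p.1 : Rn n) : ℝ) := by
        fun_prop
      have hr : ContinuousAt (fun p : Sph n × Sph n => gauge (K : Set (Rn n)) (p.1 : Rn n) *
          supportFn (K : Set (Rn n)) (p.2 : Rn n)) (w₀, u) := by
        refine ContinuousAt.mul ?_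
          ((continuous_supportFn_sphere K).comp continuous_snd).continuousAt
        exact ContinuousAt.comp (g := gauge (K : Set (Rn n)))
          (f := fun p : Sph n × Sph n => (p.1 : Rn n)) hgc (by fun_prop)
      filter_upwards [hl.continuousAt.eventually_lt hr hlt] with p hp _
      exact hp
  have hnhds : {w : Sph n | (w : Rn n) ∈ openCone (interior (K : Set (Rn n))) ∧ ∀ u : Sph n,
      inner ℝ (u : Rn n) (v : Rn n) ≤ 0 → inner ℝ (u : Rn n) (w : Rn n) <
        gauge (K : Set (Rn n)) (w : Rn n) * supportFn (K : Set (Rn n)) (u : Rn n)} ∈ 𝓝 w₀ := by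
    filter_upwards [hnear, (hopen.preimage continuous_subtype_val).mem_nhds hw₀] with w hw hw'
    exact ⟨hw', fun u => hw u trivial⟩
  have hE : MeasurableSet {u : Sph n | 0 < inner ℝ (u : Rn n) (v : Rn n)} :=
    (isOpen_lt continuous_const (by fun_prop : Continuous fun u : Sph n =>
      (inner ℝ (u : Rn n) (v : Rn n) : ℝ))).measurableSet
  rw [dualCurvature_eq_setIntegral h0 hint hE]
  refine mul_pos (by positivity) ?_
  rw [setIntegral_pos_iff_support_of_nonneg_ae
    (Eventually.of_forall hG.radialDensity_nonneg) (hG.integrable_radialDensity h0).integrableOn]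
  refine (Measure.measure_pos_of_mem_nhds (sphereMeasure n) hnhds).trans_le (measure_mono_ae ?_)
  filter_upwards [ae_isRegularDirection_or h0 hint] with w hw hwU
  have hρ := (mem_openCone_iff h0).1 (openCone_mono interior_subset hwU.1)
  have hreg := hw.resolve_right hρ.ne'
  refine ⟨(hG.radialDensity_pos hρ).ne', ?_⟩
  change 0 < inner ℝ (radialGauss K w : Rn n) (v : Rn n)
  by_contra! hle
  have h1 := hwU.2 _ hle
  rw [gauge_eq_inv_radialFn h0 (openCone_mono interior_subset hwU.1),
    ← (hreg.normal_iff _).2 rfl, inv_mul_cancel_left₀ hρ.ne'] at h1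
  exact lt_irrefl _ h1

theorem notConcentrated_of_curvature_eq (hG : IsRadialDensity G) (h0 : 0 ∈ K)
    (hint : (interior (K : Set (Rn n))).Nonempty)
    (hn : 2 ≤ n) (hXi : Measure.hausdorffMeasure ((n - 1 : ℕ) : ℝ) (Xi (K : Set (Rn n))) = 0)
    {μ : Measure (Sph n)} [IsFiniteMeasure μ] {f : Sph n → ℝ} {τ : ℝ} (hτ : 0 < τ)
    (heq : ∀ E : Set (Sph n), MeasurableSet E →
      ∫ u in E, f u ∂μ = τ * dualCurvature G (K : Set (Rn n)) E) :
    NotConcentratedOnClosedHemisphere μ := by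
  intro v
  have hnn : ∀ u : Sph n, 0 ≤ max (inner ℝ (u : Rn n) (v : Rn n)) 0 := fun u => le_max_right _ _
  refine lt_of_le_of_ne (integral_nonneg hnn) fun h => ?_
  have hae := (integral_eq_zero_iff_of_nonneg hnn
    (integrable_of_continuous_sphere (by fun_prop))).1 h.symm
  have hE : MeasurableSet {u : Sph n | 0 < inner ℝ (u : Rn n) (v : Rn n)} :=
    (isOpen_lt continuous_const (by fun_prop : Continuous fun u : Sph n =>
      (inner ℝ (u : Rn n) (v : Rn n) : ℝ))).measurableSet
  have hnull : μ {u : Sph n | 0 < inner ℝ (u : Rn n) (v : Rn n)} = 0 := by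
    refine measure_eq_zero_iff_ae_notMem.2 ?_
    filter_upwards [hae] with u hu hpos
    exact (lt_max_of_lt_left hpos).ne' hu
  have h1 := heq _ hE
  rw [setIntegral_measure_zero _ hnull] at h1
  exact (mul_pos hτ (dualCurvature_pos hG h0 hint hn hXi v)).ne h1

end Necessity

/-! ### The Orlicz function -/

section Orlicz

/-- The function `s ↦ ψ(s) / s`, extended by `0` to the negative half-line. -/
noncomputable def quotientFn (ψ : ℝ → ℝ) (s : ℝ) : ℝ := if s ≤ 0 then 0 else ψ s / s

variable {ψ : ℝ → ℝ}

theorem quotientFn_of_pos {s : ℝ} (hs : 0 < s) : quotientFn ψ s = ψ s / s := if_neg (not_le.2 hs)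

theorem quotientFn_of_nonpos {s : ℝ} (hs : s ≤ 0) : quotientFn ψ s = 0 := if_pos hs

theorem quotientFn_pos (hψ : ∀ t : ℝ, 0 < t → 0 < ψ t) {s : ℝ} (hs : 0 < s) :
    0 < quotientFn ψ s := by
  rw [quotientFn_of_pos hs]; exact div_pos (hψ s hs) hs

theorem quotientFn_nonneg (hψ : ∀ t : ℝ, 0 < t → 0 < ψ t) (s : ℝ) : 0 ≤ quotientFn ψ s := by
  rcases le_or_gt s 0 with hs | hs
  · rw [quotientFn_of_nonpos hs]
  · exact (quotientFn_pos hψ hs).le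

theorem quotientFn_mul_self (hψ0 : ψ 0 = 0) {s : ℝ} (hs : 0 ≤ s) : quotientFn ψ s * s = ψ s := by
  rcases hs.eq_or_lt with rfl | hs
  · rw [mul_zero, hψ0]
  · rw [quotientFn_of_pos hs, div_mul_cancel₀ _ hs.ne']

theorem continuous_quotientFn (hψc : ContinuousOn ψ (Ioi 0))
    (hψl : Tendsto (fun t : ℝ => ψ t / t) (𝓝[>] 0) (𝓝 0)) : Continuous (quotientFn ψ) := by
  refine continuous_iff_continuousAt.2 fun s => ?_
  rcases lt_trichotomy s 0 with hs | rfl | hs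
  · refine (continuousAt_const (y := (0 : ℝ))).congr ?_
    filter_upwards [Iio_mem_nhds hs] with t ht
    rw [quotientFn_of_nonpos (le_of_lt ht)]
  · refine continuousAt_iff_continuous_left'_right'.2 ⟨?_, ?_⟩ <;>
      rw [ContinuousWithinAt, quotientFn_of_nonpos le_rfl]
    · refine tendsto_const_nhds.congr' ?_
      filter_upwards [self_mem_nhdsWithin] with t ht
      rw [quotientFn_of_nonpos (le_of_lt ht)]
    · refine hψl.congr' ?_
      filter_upwards [self_mem_nhdsWithin] with t ht
      rw [quotientFn_of_pos ht]
  · refine ((hψc.continuousAt (Ioi_mem_nhds hs)).div continuousAt_id hs.ne').congr ?_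
    filter_upwards [Ioi_mem_nhds hs] with t ht
    rw [quotientFn_of_pos ht]; rfl

theorem tendsto_primitive_quotientFn (hψ : ∀ t : ℝ, 0 < t → 0 < ψ t)
    (hc : Continuous (quotientFn ψ))
    (hψi : ∫⁻ s in Ioi (1 : ℝ), ENNReal.ofReal (ψ s / s) = ⊤) :
    Tendsto (primitive (quotientFn ψ)) atTop atTop := by
  have hmono := monotone_primitive hc (quotientFn_nonneg hψ)
  rcases tendsto_atTop_of_monotone hmono with h | ⟨l, hl⟩
  · exact h
  exfalso
  have hint : IntegrableOn (quotientFn ψ) (Ioi 1) := by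
    refine integrableOn_Ioi_of_intervalIntegral_norm_bounded (l - primitive (quotientFn ψ) 1) 1
      (fun i : ℝ => hc.integrableOn_Ioc) tendsto_id (Eventually.of_forall fun t => ?_)
    have h1 : ∫ s in (1 : ℝ)..t, ‖quotientFn ψ s‖ = ∫ s in (1 : ℝ)..t, quotientFn ψ s :=
      intervalIntegral.integral_congr fun s _ => Real.norm_of_nonneg (quotientFn_nonneg hψ s)
    have h2 : ∫ s in (1 : ℝ)..t, quotientFn ψ s =
        primitive (quotientFn ψ) t - primitive (quotientFn ψ) 1 :=
      (intervalIntegral.integral_interval_sub_left (hc.intervalIntegrable _ _)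
        (hc.intervalIntegrable _ _)).symm
    rw [id, h1, h2]
    exact sub_le_sub_right (hmono.ge_of_tendsto hl t) _
  have hfin := hint.2
  rw [hasFiniteIntegral_iff_ofReal (Eventually.of_forall (quotientFn_nonneg hψ)),
    setLIntegral_congr_fun (g := fun s => ENNReal.ofReal (ψ s / s)) measurableSet_Ioi
      (fun s hs => by rw [quotientFn_of_pos (zero_lt_one.trans hs)]), hψi] at hfin
  exact lt_irrefl _ hfin

end Orlicz

end DualMinkowski

theorem mainTheorem3
    (n : ℕ) (hn : 2 ≤ n)
    (G : ℝ → DualMinkowski.Sph n → ℝ)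
    (hG_nonneg : ∀ t : ℝ, 0 ≤ t → ∀ u : DualMinkowski.Sph n, 0 ≤ G t u)
    (hG_cont : ContinuousOn (fun p : ℝ × DualMinkowski.Sph n => G p.1 p.2)
      (Set.Ici (0 : ℝ) ×ˢ Set.univ))
    (hG_diff : ∀ t : ℝ, 0 < t → ∀ u : DualMinkowski.Sph n,
      DifferentiableAt ℝ (fun s : ℝ => G s u) t)
    (hGt_pos : ∀ t : ℝ, 0 < t → ∀ u : DualMinkowski.Sph n, 0 < deriv (fun s : ℝ => G s u) t)
    -- the function below takes the value `0` at `t = 0`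
    (htGt_cont : ContinuousOn
      (fun p : ℝ × DualMinkowski.Sph n => p.1 * deriv (fun s : ℝ => G s p.2) p.1)
      (Set.Ici (0 : ℝ) ×ˢ Set.univ))
    (ψ : ℝ → ℝ)
    (hψ_zero : ψ 0 = 0)
    (hψ_pos : ∀ t : ℝ, 0 < t → 0 < ψ t)
    (hψ_cont : ContinuousOn ψ (Set.Ioi 0))
    (hψ_lim : Filter.Tendsto (fun t : ℝ => ψ t / t) (nhdsWithin 0 (Set.Ioi 0)) (nhds 0))
    (hψ_int : ∫⁻ s in Set.Ioi (1 : ℝ), ENNReal.ofReal (ψ s / s) = ⊤)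
    (μ : MeasureTheory.Measure (DualMinkowski.Sph n)) [MeasureTheory.IsFiniteMeasure μ] :
    DualMinkowski.NotConcentratedOnClosedHemisphere μ ↔
      ∃ (K : ConvexBody (DualMinkowski.Rn n)) (τ : ℝ),
        (0 : DualMinkowski.Rn n) ∈ K ∧
        (interior (K : Set (DualMinkowski.Rn n))).Nonempty ∧
        0 < τ ∧
        MeasureTheory.Measure.euclideanHausdorffMeasure (n - 1)
          (DualMinkowski.Xi (K : Set (DualMinkowski.Rn n))) = 0 ∧
        (∀ E : Set (DualMinkowski.Sph n), MeasurableSet E →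
          ∫ u in E, ψ (DualMinkowski.supportFn (K : Set (DualMinkowski.Rn n)) u) ∂μ
            = τ * DualMinkowski.dualCurvature G (K : Set (DualMinkowski.Rn n)) E) ∧
        τ = (1 / DualMinkowski.dualCurvature G (K : Set (DualMinkowski.Rn n)) Set.univ) *
          ∫ u, ψ (DualMinkowski.supportFn (K : Set (DualMinkowski.Rn n)) u) ∂μ := by
  have hG : DualMinkowski.IsRadialDensity G := ⟨hG_cont, hG_diff, hGt_pos, htGt_cont⟩
  have hn0 : (0 : ℝ) < n := by exact_mod_cast (by lia : 0 < n)
  constructor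
  · intro hμ
    have : Nonempty (DualMinkowski.Sph n) :=
      ⟨⟨EuclideanSpace.single (⟨0, by lia⟩ : Fin n) (1 : ℝ), by simp⟩⟩
    have hφ := DualMinkowski.continuous_quotientFn hψ_cont hψ_lim
    have hφ0 := DualMinkowski.quotientFn_nonneg hψ_pos
    obtain ⟨K, h0, hint, hmin⟩ := DualMinkowski.exists_minimizer hG hμ hφ hφ0
      (DualMinkowski.tendsto_primitive_quotientFn hψ_pos hφ hψ_int)
    have hK : DualMinkowski.IsMinimizer G (DualMinkowski.quotientFn ψ) μ K := ⟨h0, hint, hmin⟩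
    obtain ⟨τ, hτ, heq⟩ := hK.exists_multiplier hμ hG hφ hφ0 fun s hs =>
      DualMinkowski.quotientFn_pos hψ_pos hs
    have hw : ∀ v : DualMinkowski.Sph n,
        DualMinkowski.quotientFn ψ (DualMinkowski.supportFn (K : Set (DualMinkowski.Rn n)) v) *
          DualMinkowski.supportFn (K : Set (DualMinkowski.Rn n)) v =
        ψ (DualMinkowski.supportFn (K : Set (DualMinkowski.Rn n)) v) := fun v =>
      DualMinkowski.quotientFn_mul_self hψ_zero (DualMinkowski.supportFn_nonneg h0 _)
    have hcurv : ∀ E : Set (DualMinkowski.Sph n), MeasurableSet E →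
        ∫ u in E, ψ (DualMinkowski.supportFn (K : Set (DualMinkowski.Rn n)) u) ∂μ
          = (τ * n) * DualMinkowski.dualCurvature G (K : Set (DualMinkowski.Rn n)) E := by
      intro E hE
      have hind : ∀ {m : Measure (DualMinkowski.Sph n)} (f : DualMinkowski.Sph n → ℝ)
          {S : Set (DualMinkowski.Sph n)}, MeasurableSet S →
          ∫ u, f u * S.indicator (fun _ => (1 : ℝ)) u ∂m = ∫ u in S, f u ∂m := by
        intro m f S hS
        rw [← integral_indicator hS]
        congr 1 with u
        by_cases hu : u ∈ S <;> simp [hu]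
      have h1 := (DualMinkowski.integral_weight_mul_eq hG hφ hφ0 h0 hτ heq
        (k := E.indicator fun _ => (1 : ℝ)) (measurable_const.indicator hE)
        ((DualMinkowski.integrable_of_continuous_sphere
          (DualMinkowski.continuous_weight hφ)).mul_bdd (c := 1)
          (measurable_const.indicator hE).aestronglyMeasurable
          (Eventually.of_forall fun v => by
            by_cases hv : v ∈ E <;> simp [hv]))).2
      simp only [hw] at h1
      rw [hind _ hE] at h1
      rw [h1, DualMinkowski.dualCurvature_eq_setIntegral h0 hint hE,
        ← hind _ (DualMinkowski.measurable_radialGauss K hE)]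
      have h2 : ∀ I : ℝ, τ * n * (1 / n * I) = τ * I := fun I => by field_simp
      rw [h2]
      rfl
    have hC : 0 < DualMinkowski.dualCurvature G (K : Set (DualMinkowski.Rn n)) Set.univ := by
      rw [DualMinkowski.dualCurvature_eq_setIntegral h0 hint MeasurableSet.univ, preimage_univ,
        setIntegral_univ]
      exact mul_pos (by positivity) (DualMinkowski.integral_radialDensity_pos hG h0 hint)
    refine ⟨K, τ * n, h0, hint, by positivity,
      DualMinkowski.euclideanHausdorffMeasure_eq_zero_iff.2
        (hK.hausdorffMeasure_Xi_eq_zero hn hG hφ hφ0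
          (DualMinkowski.quotientFn_of_nonpos le_rfl) hτ heq), hcurv, ?_⟩
    have h1 := hcurv _ MeasurableSet.univ
    rw [setIntegral_univ] at h1
    rw [h1, one_div, mul_comm (τ * n), inv_mul_cancel_left₀ hC.ne']
  · rintro ⟨K, τ, h0, hint, hτ, hXi, heq, -⟩
    exact DualMinkowski.notConcentrated_of_curvature_eq hG h0 hint hn
      (DualMinkowski.euclideanHausdorffMeasure_eq_zero_iff.1 hXi) hτ heq
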